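/- Let $\alpha,\eta,\theta,R$ be real $N\times N$ matrices with $\alpha^{T}=\alpha>0$, $\eta^{T}=\eta\ge 0$, $\theta^{T}=-\theta$, $R^{T}=R\ge 0$ and $N_R=\operatorname{rank}R>0$, and for $\beta\ge 0$ consider the gyroscopic-dissipative Lagrangian system $$\alpha\ddot Q+(2\theta+\beta R)\dot Q+\eta Q=0 .$$ Its system operator on $\mathbb{C}^{2N}=\mathbb{C}^N\oplus\mathbb{C}^N$ is $A(\beta)=\Omega-\mathrm{i}\beta B$, where $$\Omega=\begin{bmatrix}-2\mathrm{i}K_p\theta K_p^{T}&-\mathrm{i}\Phi^{T}\\ \mathrm{i}\Phi&0\end{bmatrix},\quad B=\begin{bmatrix}K_pRK_p^{T}&0\\0&0\end{bmatrix},\quad K_p=\sqrt{\alpha}^{\,-1},\ K_q=\sqrt{\eta},\ \Phi=K_qK_p^{T}.$$ The quality factor of $\zeta\in\mathbb{C}$ is $Q_\zeta=\frac12\frac{|\operatorname{Re}\zeta|}{-\operatorname{Im}\zeta}$, with $Q_\zeta=+\infty$ if $\operatorname{Im}\zeta=0\ne\operatorname{Re}\zeta$ and $Q_\zeta=0$ if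 $\zeta=0$. A function of $\beta$ is called analytic (has a pole) at $\beta=\infty$ if for all large $\beta$ it is given by a function of $z=\beta^{-1}$ that is analytic at (is meromorphic with a pole at) $z=0$. A family of modes consists of functions $\zeta_j(\beta)\in\mathbb{C}$, $w_j(\beta)\in\mathbb{C}^{2N}$, $1\le j\le 2N$, such that for all large $\beta$ one has $A(\beta)w_j(\beta)=\zeta_j(\beta)w_j(\beta)$ and $w_1(\beta),\dots,w_{2N}(\beta)$ is a basis of $\mathbb{C}^{2N}$, all $w_j$ are analytic at $\beta=\infty$, the $\zeta_j$ with $1\le j\le N_R$ (high-loss modes) have a pole at $\beta=\infty$, and the $\zeta_j$ with $N_R+1\le j\le 2N$ (low-loss modes) are analytic at $\beta=\infty$. Below, $f(\beta)\searrow 0$ means that $f(\beta)\to0$ as $\beta\to\infty$ and that, on some interval $[b,\infty)$, $f$ is either strictly decreasing or identically $0$; $f(\beta)\nearrow+\infty$ means that $f(\beta)\to+\infty$ as $\beta\to\infty$ and that, on some interval $[b,\infty)$, $f$ is either strictly increasing or identically $+\infty$. **Theorem (Quality factor-duality).** A family of modes exists, and for every family of modes the following holds. 1. $Q_{\zeta_j(\beta)}\searrow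 0$ for the high-loss modes, $1\le j\le N_R$. 2. If $\operatorname{Ker}R\cap\operatorname{Ker}\eta=\{0\}$, then the low-loss modes can be reindexed so that $\lim_{\beta\to\infty}\zeta_j(\beta)=0$ for $N_R+1\le j\le 2N_R$ and $\lim_{\beta\to\infty}\zeta_j(\beta)=\rho_j$ with $\rho_j\in\mathbb{R}\setminus\{0\}$ for $2N_R+1\le j\le 2N$; and whenever they are so indexed, $Q_{\zeta_j(\beta)}\searrow 0$ for $N_R+1\le j\le 2N_R$ (the $N_R$ low-loss/low-Q modes) and $Q_{\zeta_j(\beta)}\nearrow+\infty$ for $2N_R+1\le j\le 2N$ (the $2(N-N_R)$ low-loss/high-Q modes). -/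

import Mathlib

open Filter Topology Set
open scoped ENNReal MatrixOrder

/-- A gyroscopic-dissipative Lagrangian system `α Q'' + (2 θ + β R) Q' + η Q = 0` with `N` degrees
of freedom (the loss parameter `β ≥ 0` is kept as a variable): real `N × N` matrices with
`αᵀ = α > 0`, `ηᵀ = η ≥ 0`, `θᵀ = -θ`, `Rᵀ = R ≥ 0` and `rank R > 0`. -/
structure LagrangianSystem (N : ℕ) where
  α : Matrix (Fin N) (Fin N) ℝ
  η : Matrix (Fin N) (Fin N) ℝ
  θ : Matrix (Fin N) (Fin N) ℝ
  R : Matrix (Fin N) (Fin N) ℝ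
  α_posDef : α.PosDef
  η_posSemidef : η.PosSemidef
  θ_skew : θ.transpose = -θ
  R_posSemidef : R.PosSemidef
  rank_pos : 0 < R.rank

namespace LagrangianSystem

variable {N : ℕ} (S : LagrangianSystem N)

/-- `N_R = rank R`. -/
noncomputable def lossRank : ℕ := S.R.rank

/-- `K_p = (√α)⁻¹`. -/
noncomputable def Kp : Matrix (Fin N) (Fin N) ℝ := (CFC.sqrt S.α)⁻¹

/-- `K_q = √η`. -/
noncomputable def Kq : Matrix (Fin N) (Fin N) ℝ := CFC.sqrt S.η

/-- `Φ = K_q K_pᵀ`. -/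
noncomputable def Phi : Matrix (Fin N) (Fin N) ℝ := S.Kq * S.Kp.transpose

/-- The frequency operator `Ω = [[-2i K_p θ K_pᵀ, -i Φᵀ], [i Φ, 0]]` on `ℂ^{2N} = ℂ^N ⊕ ℂ^N`. -/
noncomputable def Omega : Matrix (Fin N ⊕ Fin N) (Fin N ⊕ Fin N) ℂ :=
  Matrix.fromBlocks
    ((-2 * Complex.I) • (S.Kp * S.θ * S.Kp.transpose).map Complex.ofReal)
    ((-Complex.I) • S.Phi.transpose.map Complex.ofReal)
    (Complex.I • S.Phi.map Complex.ofReal)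
    0

/-- The dissipation operator `B = [[K_p R K_pᵀ, 0], [0, 0]]`. -/
noncomputable def B : Matrix (Fin N ⊕ Fin N) (Fin N ⊕ Fin N) ℂ :=
  Matrix.fromBlocks ((S.Kp * S.R * S.Kp.transpose).map Complex.ofReal) 0 0 0

/-- The system operator `A(β) = Ω - i β B`. -/
noncomputable def A (β : ℝ) : Matrix (Fin N ⊕ Fin N) (Fin N ⊕ Fin N) ℂ :=
  S.Omega - (Complex.I * (β : ℂ)) • S.B

end LagrangianSystem

/-- `f` is analytic at `β = ∞`: for large `β` it is an analytic function of `z = β⁻¹` near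
`z = 0`. -/
def AnalyticAtInfinity {E : Type*} [NormedAddCommGroup E] [NormedSpace ℂ E] (f : ℝ → E) : Prop :=
  ∃ g : ℂ → E, AnalyticAt ℂ g 0 ∧ ∀ᶠ β : ℝ in atTop, f β = g ((β : ℂ)⁻¹)

/-- `f` has a pole at `β = ∞`: for large `β` it is a meromorphic function of `z = β⁻¹` near
`z = 0` with a pole at `z = 0`. -/
def HasPoleAtInfinity (f : ℝ → ℂ) : Prop :=
  ∃ g : ℂ → ℂ, MeromorphicAt g 0 ∧ meromorphicOrderAt g 0 < 0 ∧
    ∀ᶠ β : ℝ in atTop, f β = g ((β : ℂ)⁻¹)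

namespace LagrangianSystem

variable {N : ℕ} (S : LagrangianSystem N)

/-- The eigenpairs `ζ_j(β)`, `w_j(β)`, `1 ≤ j ≤ 2N` (here `j` runs from `0` to `2N - 1`), of the
high-loss regime. For large `β` the `w_j(β)` are a basis of `ℂ^{2N}` of eigenvectors of `A(β)`. The
eigenvectors are analytic at `β = ∞`, the first `N_R` eigenvalues (high-loss) have poles at
`β = ∞`, and the remaining `2N - N_R` ones (low-loss) are analytic at `β = ∞`. -/
structure IsModeFamily (ζ : Fin (2 * N) → ℝ → ℂ)
    (w : Fin (2 * N) → ℝ → (Fin N ⊕ Fin N → ℂ)) : Prop where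
  eigen : ∀ᶠ β : ℝ in atTop, ∀ j, (S.A β).mulVec (w j β) = ζ j β • w j β
  basis : ∀ᶠ β : ℝ in atTop, LinearIndependent ℂ (fun j => w j β)
  vec_analytic : ∀ j, AnalyticAtInfinity (w j)
  high_loss : ∀ j : Fin (2 * N), (j : ℕ) < S.lossRank → HasPoleAtInfinity (ζ j)
  low_loss : ∀ j : Fin (2 * N), S.lossRank ≤ (j : ℕ) → AnalyticAtInfinity (ζ j)

/-- The low-loss eigenvalues are indexed by their limits: `ζ_j → 0` for `N_R + 1 ≤ j ≤ 2 N_R` and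
`ζ_j → ρ_j ≠ 0` (`ρ_j` real) for `2 N_R + 1 ≤ j ≤ 2N` (shifted by one, as `j` starts at `0`). -/
def IsIndexedByLimits (ζ : Fin (2 * N) → ℝ → ℂ) : Prop :=
  (∀ j : Fin (2 * N), S.lossRank ≤ (j : ℕ) → (j : ℕ) < 2 * S.lossRank →
    Tendsto (ζ j) atTop (𝓝 0)) ∧
  (∀ j : Fin (2 * N), 2 * S.lossRank ≤ (j : ℕ) →
    ∃ ρ : ℝ, ρ ≠ 0 ∧ Tendsto (ζ j) atTop (𝓝 (ρ : ℂ)))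

end LagrangianSystem

/-- The quality factor `Q_ζ = |Re ζ| / (2 (-Im ζ))`, with `Q_ζ = +∞` if `Im ζ = 0`, `Re ζ ≠ 0`, and
`Q_ζ = 0` if `ζ = 0`. -/
noncomputable def qFactor (ζ : ℂ) : ℝ≥0∞ :=
  if ζ = 0 then 0
  else if ζ.im = 0 then ⊤
  else ENNReal.ofReal (1 / 2 * (|ζ.re| / -ζ.im))

/-- `f(β) ↘ 0` as `β → ∞`: `f` tends to `0` and, for large `β`, is strictly decreasing unless it is
already identically `0` (the overdamped modes). -/
def DecreasesToZero (f : ℝ → ℝ≥0∞) : Prop :=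
  (∃ b : ℝ, (∀ β ∈ Ici b, f β = 0) ∨ StrictAntiOn f (Ici b)) ∧ Tendsto f atTop (𝓝 0)

/-- `f(β) ↗ +∞` as `β → ∞`: `f` tends to `+∞` and, for large `β`, is strictly increasing unless it
is already identically `+∞` (the undamped modes). -/
def IncreasesToTop (f : ℝ → ℝ≥0∞) : Prop :=
  (∃ b : ℝ, (∀ β ∈ Ici b, f β = ⊤) ∨ StrictMonoOn f (Ici b)) ∧ Tendsto f atTop (𝓝 ⊤)

/-!
For `z = i/β` one has `Ω - iβB = -iβ (B + zΩ)`, and `B + zΩ` is Hermitian for real `z`. By Rellich's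
theorem it has an eigenbasis analytic in `z`, which gives a family of modes: the `rank B = N_R`
eigenvalues of `B + zΩ` that do not vanish at `z = 0` yield modes with a pole, the others yield
modes whose limits are the eigenvalues of the compression of `Ω` to `ker B`. If `ker R ∩ ker η = 0`,
then exactly `N_R` of these limits are `0`. Any other family has the same limits in the Riemann
sphere, with multiplicity, since for large `β` both families list the roots of the same
characteristic polynomial.

The numerical range gives `Im ζ ≤ 0` and, for every mode, a bound on `Re ζ` independent of `β`. As
`Re ζ` and `Im ζ` are real analytic in `1/β` up to a power of `β`, the quality factor is eventually
constant or strictly monotone, so that only its limit matters. This limit is `0` if `ζ` has a pole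
and `∞` if `ζ → ρ ≠ 0`. If `ζ → 0` and `w → w₀ ≠ 0`, then `w₀ = (0, ψ)`, and `ζ₁ = lim β ζ` and
`φ₁ = lim β φ`, where `φ` is the upper half of `w`, satisfy
`ζ₁ ‖ψ‖² = -i ⟨φ₁, K_p R K_pᵀ φ₁⟩`. Hence `ζ₁` is imaginary, and if it is not `0` then
`Re ζ / Im ζ → 0`, whereas `ζ₁ = 0` forces `ζ = 0` for large `β`.
-/

section BlockDiagonalization

variable {𝔸 : Type*} [Ring 𝔸] {P x : 𝔸}

theorem eq_zero_of_mul_eq_mul_one_sub_of_commute (hP : IsIdempotentElem P)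
    (h : P * x = x * (1 - P)) (hc : Commute P x) : x = 0 := by
  have hxP : x * P = 0 := by
    calc x * P = P * x * P := by rw [hc.eq, mul_assoc, hP.eq]
      _ = x * ((1 - P) * P) := by rw [h, mul_assoc]
      _ = 0 := by rw [hP.one_sub_mul_self, mul_zero]
  rw [hc.eq, mul_sub, mul_one, hxP, sub_zero] at h
  exact h.symm

end BlockDiagonalization

section AnalyticBlockDiagonalization

variable {𝕜 𝔸 : Type*} [RCLike 𝕜] [NormedRing 𝔸] [NormedAlgebra 𝕜 𝔸] {P T₀ : 𝔸}

variable (𝕜) in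
/-- The block-diagonal part `P x P + (1 - P) x (1 - P)` of `x` with respect to `P`, as a continuous
linear map. -/
noncomputable def diagonalPart (P : 𝔸) : 𝔸 →L[𝕜] 𝔸 :=
  .mulLeftRight 𝕜 𝔸 P P + .mulLeftRight 𝕜 𝔸 (1 - P) (1 - P)

variable (𝕜) in
/-- The off-diagonal part `P x (1 - P) + (1 - P) x P` of `x` with respect to `P`, as a continuous
linear map. -/
noncomputable def offDiagonalPart (P : 𝔸) : 𝔸 →L[𝕜] 𝔸 :=
  .mulLeftRight 𝕜 𝔸 P (1 - P) + .mulLeftRight 𝕜 𝔸 (1 - P) P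

theorem diagonalPart_apply (P x : 𝔸) :
    diagonalPart 𝕜 P x = P * x * P + (1 - P) * x * (1 - P) := rfl

theorem offDiagonalPart_apply (P x : 𝔸) :
    offDiagonalPart 𝕜 P x = P * x * (1 - P) + (1 - P) * x * P := rfl

theorem diagonalPart_add_offDiagonalPart (P x : 𝔸) :
    diagonalPart 𝕜 P x + offDiagonalPart 𝕜 P x = x := by
  rw [diagonalPart_apply, offDiagonalPart_apply]
  noncomm_ring

theorem commute_diagonalPart (hP : IsIdempotentElem P) (x : 𝔸) :
    Commute P (diagonalPart 𝕜 P x) := by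
  have hl : P * diagonalPart 𝕜 P x = P * x * P := by
    simp [diagonalPart_apply, mul_add, ← mul_assoc, hP.eq, hP.mul_one_sub_self]
  have hr : diagonalPart 𝕜 P x * P = P * x * P := by
    simp [diagonalPart_apply, add_mul, mul_assoc, hP.eq, hP.one_sub_mul_self]
  exact hl.trans hr.symm

theorem mul_offDiagonalPart (hP : IsIdempotentElem P) (x : 𝔸) :
    P * offDiagonalPart 𝕜 P x = offDiagonalPart 𝕜 P x * (1 - P) := by
  have hl : P * offDiagonalPart 𝕜 P x = P * x * (1 - P) := by
    simp [offDiagonalPart_apply, mul_add, ← mul_assoc, hP.eq, hP.mul_one_sub_self]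
  have hr : offDiagonalPart 𝕜 P x * (1 - P) = P * x * (1 - P) := by
    simp [offDiagonalPart_apply, add_mul, mul_assoc, hP.one_sub.eq, hP.mul_one_sub_self]
  exact hl.trans hr.symm

theorem offDiagonalPart_of_commute (hP : IsIdempotentElem P) {x : 𝔸} (h : Commute P x) :
    offDiagonalPart 𝕜 P x = 0 := by
  rw [offDiagonalPart_apply, h.eq, ((Commute.one_left x).sub_left h).eq, mul_assoc, mul_assoc,
    hP.mul_one_sub_self, hP.one_sub_mul_self, mul_zero, add_zero]

theorem diagonalPart_of_commute (hP : IsIdempotentElem P) {x : 𝔸} (h : Commute P x) :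
    diagonalPart 𝕜 P x = x := by
  simpa only [offDiagonalPart_of_commute hP h, add_zero] using
    diagonalPart_add_offDiagonalPart (𝕜 := 𝕜) P x

theorem eq_zero_of_commutator_offDiagonalPart_eq_diagonalPart (hP : IsIdempotentElem P)
    (hT₀ : ∀ X, Commute T₀ X → Commute P X) {x : 𝔸}
    (hx : T₀ * offDiagonalPart 𝕜 P x - offDiagonalPart 𝕜 P x * T₀ = diagonalPart 𝕜 P x) :
    x = 0 := by
  set E := offDiagonalPart 𝕜 P x with hE
  set D := diagonalPart 𝕜 P x with hD
  have hPE : P * E = E * (1 - P) := mul_offDiagonalPart hP x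
  have hPT : Commute P T₀ := hT₀ T₀ (Commute.refl T₀)
  have hQT : (1 - P) * T₀ = T₀ * (1 - P) := ((Commute.one_left T₀).sub_left hPT).eq
  have hPD : P * D = D * (1 - P) := by
    calc P * D = T₀ * (P * E) - P * E * T₀ := by
          rw [← hx, mul_sub, ← mul_assoc, hPT.eq, mul_assoc, mul_assoc]
      _ = T₀ * E * (1 - P) - E * T₀ * (1 - P) := by
          rw [hPE, mul_assoc, mul_assoc, mul_assoc, hQT]
      _ = D * (1 - P) := by rw [← sub_mul, hx]
  have hD0 : D = 0 :=
    eq_zero_of_mul_eq_mul_one_sub_of_commute hP hPD (commute_diagonalPart hP x)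
  have hE0 : E = 0 :=
    eq_zero_of_mul_eq_mul_one_sub_of_commute hP hPE (hT₀ E (sub_eq_zero.1 (hx.trans hD0)))
  rw [← diagonalPart_add_offDiagonalPart (𝕜 := 𝕜) P x, ← hD, ← hE, hD0, hE0, add_zero]

variable (𝕜) in
/-- The defect of the equation `T U = U D` with `U = 1 + offDiagonalPart P Y` and
`D = diagonalPart P Y`, in terms of the pair `(T, Y)`. -/
noncomputable def blockDefect (P T Y : 𝔸) : 𝔸 :=
  T * (1 + offDiagonalPart 𝕜 P Y) - (1 + offDiagonalPart 𝕜 P Y) * diagonalPart 𝕜 P Y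

theorem blockDefect_self (hP : IsIdempotentElem P) (h : Commute P T₀) :
    blockDefect 𝕜 P T₀ T₀ = 0 := by
  simp [blockDefect, offDiagonalPart_of_commute hP h, diagonalPart_of_commute hP h]

theorem hasFDerivAt_blockDefect (hP : IsIdempotentElem P) (h : Commute P T₀) :
    HasFDerivAt (𝕜 := 𝕜) (blockDefect 𝕜 P T₀)
      (.mul 𝕜 𝔸 T₀ ∘L offDiagonalPart 𝕜 P
        - (ContinuousLinearMap.mul 𝕜 𝔸).flip T₀ ∘L offDiagonalPart 𝕜 P - diagonalPart 𝕜 P) T₀ := by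
  have hoff := ((offDiagonalPart 𝕜 P).hasFDerivAt (x := T₀)).const_add (1 : 𝔸)
  refine ((hoff.const_mul T₀).sub
    (hoff.mul' ((diagonalPart 𝕜 P).hasFDerivAt (x := T₀)))).congr_fderiv ?_
  ext x
  simp only [offDiagonalPart_of_commute hP h, diagonalPart_of_commute hP h, add_zero, one_smul,
    sub_apply, smul_apply, smul_eq_mul, add_apply, MulOpposite.smul_eq_mul_unop,
    MulOpposite.unop_op, ContinuousLinearMap.comp_apply, ContinuousLinearMap.mul_apply',
    ContinuousLinearMap.flip_apply]
  abel

theorem analyticAt_blockDefect {T : 𝕜 → 𝔸} {z : 𝕜} (hT : AnalyticAt 𝕜 T z) (P Y : 𝔸) :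
    AnalyticAt 𝕜 (fun p : 𝕜 × 𝔸 => blockDefect 𝕜 P (T p.1) p.2) (z, Y) := by
  have hU : AnalyticAt 𝕜 (fun p : 𝕜 × 𝔸 => 1 + offDiagonalPart 𝕜 P p.2) (z, Y) :=
    analyticAt_const.add (((offDiagonalPart 𝕜 P).analyticAt _).fun_comp analyticAt_snd)
  exact ((AnalyticAt.fun_comp (f := Prod.fst) hT analyticAt_fst).mul hU).sub
    (hU.mul (((diagonalPart 𝕜 P).analyticAt _).fun_comp analyticAt_snd))

theorem isInvertible_fderiv_blockDefect [FiniteDimensional 𝕜 𝔸] {T : 𝕜 → 𝔸}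
    (hT : AnalyticAt 𝕜 T 0) (hP : IsIdempotentElem P)
    (hcomm : ∀ X, Commute (T 0) X → Commute P X) :
    (fderiv 𝕜 (fun p : 𝕜 × 𝔸 => blockDefect 𝕜 P (T p.1) p.2) (0, T 0) ∘L
      .inr 𝕜 𝕜 𝔸).IsInvertible := by
  have hPT : Commute P (T 0) := hcomm _ (Commute.refl _)
  rw [((analyticAt_blockDefect hT P (T 0)).differentiableAt.hasFDerivAt.comp (T 0)
    (hasFDerivAt_prodMk_right 0 (T 0))).unique (hasFDerivAt_blockDefect hP hPT)]
  set L := ContinuousLinearMap.mul 𝕜 𝔸 (T 0) ∘L offDiagonalPart 𝕜 P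
    - (ContinuousLinearMap.mul 𝕜 𝔸).flip (T 0) ∘L offDiagonalPart 𝕜 P - diagonalPart 𝕜 P
  have hL : Function.Injective L.toLinearMap := by
    refine (injective_iff_map_eq_zero _).2 fun x hx => ?_
    refine eq_zero_of_commutator_offDiagonalPart_eq_diagonalPart (𝕜 := 𝕜) hP hcomm ?_
    exact sub_eq_zero.1 (by simpa [L] using hx)
  exact ⟨(LinearEquiv.ofInjectiveEndo L.toLinearMap hL).toContinuousLinearEquiv, by ext; rfl⟩

theorem exists_analytic_block_diagonalization [FiniteDimensional 𝕜 𝔸] {T : 𝕜 → 𝔸}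
    (hT : AnalyticAt 𝕜 T 0) (hP : IsIdempotentElem P)
    (hcomm : ∀ X, Commute (T 0) X → Commute P X) :
    ∃ U D : 𝕜 → 𝔸, AnalyticAt 𝕜 U 0 ∧ AnalyticAt 𝕜 D 0 ∧ U 0 = 1 ∧
      (∀ᶠ z in 𝓝 0, T z * U z = U z * D z) ∧ ∀ z, Commute P (D z) := by
  have : CompleteSpace 𝔸 := FiniteDimensional.complete 𝕜 𝔸
  have hPT : Commute P (T 0) := hcomm _ (Commute.refl _)
  have hF : ContDiffAt 𝕜 ⊤ (fun p : 𝕜 × 𝔸 => blockDefect 𝕜 P (T p.1) p.2) (0, T 0) :=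
    (analyticAt_blockDefect hT P (T 0)).contDiffAt
  have hF' := isInvertible_fderiv_blockDefect hT hP hcomm
  set Y := hF.implicitFunction (by simp) hF'
  have hY : AnalyticAt 𝕜 Y 0 := (hF.contDiffAt_implicitFunction (by simp) hF').analyticAt
  have hY0 : Y 0 = T 0 := hF.implicitFunction_apply_self (by simp) hF'
  refine ⟨fun z => 1 + offDiagonalPart 𝕜 P (Y z), fun z => diagonalPart 𝕜 P (Y z),
    analyticAt_const.add (((offDiagonalPart 𝕜 P).analyticAt _).fun_comp hY),
    ((diagonalPart 𝕜 P).analyticAt _).fun_comp hY, ?_, ?_, fun z => commute_diagonalPart hP _⟩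
  · simp [hY0, offDiagonalPart_of_commute hP hPT]
  · filter_upwards [hF.eventually_apply_implicitFunction (by simp) hF'] with z hz
    exact sub_eq_zero.1 (hz.trans (blockDefect_self hP hPT))

end AnalyticBlockDiagonalization

theorem tendsto_clm_apply {𝕜 E F ι : Type*} [NontriviallyNormedField 𝕜] [NormedAddCommGroup E]
    [NormedSpace 𝕜 E] [NormedAddCommGroup F] [NormedSpace 𝕜 F] {l : Filter ι} {f : ι → E →L[𝕜] F}
    {g : ι → E} {f₀ : E →L[𝕜] F} {g₀ : E} (hf : Tendsto f l (𝓝 f₀)) (hg : Tendsto g l (𝓝 g₀)) :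
    Tendsto (fun i => f i (g i)) l (𝓝 (f₀ g₀)) :=
  (isBoundedBilinearMap_apply.continuous.tendsto (f₀, g₀)).comp (hf.prodMk_nhds hg)

section SymmetricOperators

variable {V H : Type*} [NormedAddCommGroup V] [NormedSpace ℂ V] [NormedAddCommGroup H]
  [InnerProductSpace ℂ H] {J : V →L[ℂ] H} {A : V →L[ℂ] V}

/-- `A` is symmetric for the sesquilinear form pulled back along `J` from an inner product. -/
def IsSymmetricAlong (J : V →L[ℂ] H) (A : V →L[ℂ] V) : Prop :=
  ∀ u v, inner ℂ (J (A u)) (J v) = inner ℂ (J u) (J (A v))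

namespace IsSymmetricAlong

theorem sub_smul_one (hA : IsSymmetricAlong J A) {c : ℂ} (hc : starRingEnd ℂ c = c) :
    IsSymmetricAlong J (A - c • 1) := fun u v => by
  simp [hA u v, hc, mul_comm]

theorem of_smul {c : ℂ} (hc : starRingEnd ℂ c = c) (hc₀ : c ≠ 0)
    (hA : IsSymmetricAlong J (c • A)) : IsSymmetricAlong J A := fun u v => by
  have h := hA u v
  simp only [smul_apply, map_smul, inner_smul_left, inner_smul_right, hc] at h
  exact mul_left_cancel₀ hc₀ h

theorem conj_eigenvalue (hA : IsSymmetricAlong J A) (hJ : Function.Injective J) {μ : ℂ} {v : V}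
    (hv : v ≠ 0) (h : A v = μ • v) : starRingEnd ℂ μ = μ := by
  have h1 := hA v v
  rw [h, map_smul, inner_smul_left, inner_smul_right] at h1
  exact mul_right_cancel₀ (inner_self_ne_zero.2 ((map_ne_zero_iff J hJ).2 hv)) h1

theorem of_tendsto {ι : Type*} {l : Filter ι} [l.NeBot] {Js : ι → V →L[ℂ] H} {As : ι → V →L[ℂ] V}
    (hJ : Tendsto Js l (𝓝 J)) (hA : Tendsto As l (𝓝 A))
    (h : ∀ᶠ i in l, IsSymmetricAlong (Js i) (As i)) : IsSymmetricAlong J A := fun u v =>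
  tendsto_nhds_unique_of_eventuallyEq
    ((tendsto_clm_apply hJ (tendsto_clm_apply hA tendsto_const_nhds)).inner (𝕜 := ℂ)
      (tendsto_clm_apply hJ tendsto_const_nhds))
    ((tendsto_clm_apply hJ tendsto_const_nhds).inner (𝕜 := ℂ)
      (tendsto_clm_apply hJ (tendsto_clm_apply hA tendsto_const_nhds)))
    (h.mono fun _ hi => hi u v)

variable [FiniteDimensional ℂ V]

theorem conj_trace (hA : IsSymmetricAlong J A) (hJ : Function.Injective J) :
    starRingEnd ℂ (LinearMap.trace ℂ V A.toLinearMap) = LinearMap.trace ℂ V A.toLinearMap := by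
  rw [Module.End.trace_eq_sum_roots_charpoly_of_splits (IsAlgClosed.splits _), map_multiset_sum]
  refine congrArg Multiset.sum ((Multiset.map_congr rfl fun μ hμ => ?_).trans (Multiset.map_id _))
  obtain ⟨v, hv⟩ := ((Module.End.hasEigenvalue_iff_isRoot_charpoly _ _).2
    (Polynomial.isRoot_of_mem_roots hμ)).exists_hasEigenvector
  exact hA.conj_eigenvalue hJ hv.2 hv.apply_eq_smul

theorem isCompl_ker_range (hA : IsSymmetricAlong J A) (hJ : Function.Injective J) :
    IsCompl A.ker A.range := by
  rw [Submodule.isCompl_iff_disjoint _ _ (by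
    rw [add_comm, LinearMap.finrank_range_add_finrank_ker]), Submodule.disjoint_def]
  rintro x (hx : A x = 0) ⟨y, hy : A y = x⟩
  refine (map_eq_zero_iff J hJ).1 ((inner_self_eq_zero (𝕜 := ℂ)).1 ?_)
  simpa only [hx, hy, map_zero, inner_zero_left] using (hA x y).symm

end IsSymmetricAlong

end SymmetricOperators

section MeanTrace

variable {V : Type*} [NormedAddCommGroup V] [NormedSpace ℂ V] [FiniteDimensional ℂ V]

variable (V) in
/-- The trace divided by the dimension, that is, the mean of the eigenvalues. -/
noncomputable def meanTrace : (V →L[ℂ] V) →L[ℂ] ℂ :=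
  LinearMap.toContinuousLinearMap
    ((Module.finrank ℂ V : ℂ)⁻¹ • LinearMap.trace ℂ V ∘ₗ ContinuousLinearMap.coeLM ℂ)

theorem meanTrace_apply (A : V →L[ℂ] V) :
    meanTrace V A = (Module.finrank ℂ V : ℂ)⁻¹ * LinearMap.trace ℂ V A.toLinearMap := rfl

theorem meanTrace_one [Nontrivial V] : meanTrace V 1 = 1 := by
  rw [meanTrace_apply]
  exact (congrArg _ (LinearMap.trace_one ℂ V)).trans
    (inv_mul_cancel₀ (Nat.cast_ne_zero.2 Module.finrank_pos.ne'))

theorem conj_meanTrace {H : Type*} [NormedAddCommGroup H] [InnerProductSpace ℂ H] {J : V →L[ℂ] H}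
    {A : V →L[ℂ] V} (hA : IsSymmetricAlong J A) (hJ : Function.Injective J) :
    starRingEnd ℂ (meanTrace V A) = meanTrace V A := by
  rw [meanTrace_apply, map_mul, hA.conj_trace hJ, map_inv₀, Complex.conj_natCast]

theorem ne_smul_one_of_meanTrace_eq_zero {A : V →L[ℂ] V} (hA : A ≠ 0) (htr : meanTrace V A = 0)
    (μ : ℂ) : A ≠ μ • 1 := by
  rintro rfl
  have : Nontrivial V := by
    by_contra hV
    rw [not_nontrivial_iff_subsingleton] at hV
    exact hA (Subsingleton.elim _ _)
  rw [map_smul, meanTrace_one, smul_eq_mul, mul_one] at htr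
  exact hA (by rw [htr, zero_smul])

end MeanTrace

section Compression

variable {V : Type*} [NormedAddCommGroup V] [NormedSpace ℂ V] {p q : Submodule ℂ V}

/-- The compression of `A` to `p` along a complement `q`. -/
noncomputable def compression (h : p.IsTopCompl q) (A : V →L[ℂ] V) : p →L[ℂ] p :=
  p.projectionOntoL q h ∘L A ∘L p.subtypeL

theorem coe_compression_apply (h : p.IsTopCompl q) {A : V →L[ℂ] V}
    (hA : Commute (p.projectionL q h) A) (x : p) : (compression h A x : V) = A x := by
  have hx := DFunLike.congr_fun hA.eq (x : V)
  rw [mul_apply_eq_comp, mul_apply_eq_comp, Submodule.projectionL_apply_left] at hx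
  exact hx

theorem commute_projectionL_symm {h : p.IsTopCompl q} {A : V →L[ℂ] V}
    (hA : Commute (p.projectionL q h) A) : Commute (q.projectionL p h.symm) A := by
  rw [Submodule.projectionL_eq_id_sub_projectionL h]
  exact (Commute.one_left A).sub_left hA

theorem commute_projectionL_ker_range {A : V →L[ℂ] V} (h : A.ker.IsTopCompl A.range)
    {X : V →L[ℂ] V} (hX : Commute A X) : Commute (A.ker.projectionL A.range h) X := by
  have hAX : ∀ x, A (X x) = X (A x) := DFunLike.congr_fun hX.eq
  rw [ContinuousLinearMap.IsIdempotentElem.commute_iff (Submodule.isIdempotentElem_projectionL h),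
    Submodule.range_projectionL, Submodule.ker_projectionL]
  refine ⟨fun x (hx : A x = 0) => ?_, ?_⟩
  · exact (hAX x).trans (by rw [hx, map_zero])
  · rintro _ ⟨y, rfl⟩
    exact ⟨X y, hAX y⟩

end Compression

section Rellich

variable {V H : Type*} [NormedAddCommGroup V] [NormedSpace ℂ V] [NormedAddCommGroup H]
  [InnerProductSpace ℂ H] {T S U D : ℂ → V →L[ℂ] V} {J : ℂ → V →L[ℂ] H} {c : ℂ → ℂ}

/-- An analytic family of operators `T z` which, for real `z` near `0`, is symmetric for the
sesquilinear form pulled back from an inner product by an analytic family of embeddings `J z`. The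
embeddings may vary with `z` because the similarity that splits off a block is not unitary. -/
structure IsSymmetricFamily (T : ℂ → V →L[ℂ] V) (J : ℂ → V →L[ℂ] H) : Prop where
  analytic : AnalyticAt ℂ T 0
  analytic_embedding : AnalyticAt ℂ J 0
  injective : Function.Injective (J 0)
  symm : ∀ᶠ t : ℝ in 𝓝 0, IsSymmetricAlong (J t) (T t)

/-- Near `0`, the family `T z` is diagonalized by an analytic basis. -/
def HasAnalyticEigenbasis (T : ℂ → V →L[ℂ] V) : Prop :=
  ∃ (ι : Type) (_ : Fintype ι) (b : Module.Basis ι ℂ V) (e : ι → ℂ → V) (l : ι → ℂ → ℂ),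
    (∀ j, AnalyticAt ℂ (e j) 0) ∧ (∀ j, AnalyticAt ℂ (l j) 0) ∧ (∀ j, e j 0 = b j) ∧
      ∀ᶠ z in 𝓝 0, ∀ j, T z (e j z) = l j z • e j z

theorem tendsto_ofReal_nhds_zero : Tendsto (fun t : ℝ => (t : ℂ)) (𝓝 0) (𝓝 0) := by
  simpa only [Complex.ofReal_zero] using Complex.continuous_ofReal.tendsto 0

theorem analyticAt_clm_apply {E F : Type*} [NormedAddCommGroup E] [NormedSpace ℂ E]
    [NormedAddCommGroup F] [NormedSpace ℂ F] {f : ℂ → E →L[ℂ] F} {g : ℂ → E} {z : ℂ}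
    (hf : AnalyticAt ℂ f z) (hg : AnalyticAt ℂ g z) : AnalyticAt ℂ (fun z => f z (g z)) z :=
  ((ContinuousLinearMap.id ℂ (E →L[ℂ] F)).analyticAt_bilinear (f z, g z)).comp₂ hf hg

theorem analyticAt_clm_comp {E F G : Type*} [NormedAddCommGroup E] [NormedSpace ℂ E]
    [NormedAddCommGroup F] [NormedSpace ℂ F] [NormedAddCommGroup G] [NormedSpace ℂ G]
    {f : ℂ → F →L[ℂ] G} {g : ℂ → E →L[ℂ] F} {z : ℂ}
    (hf : AnalyticAt ℂ f z) (hg : AnalyticAt ℂ g z) : AnalyticAt ℂ (fun z => f z ∘L g z) z :=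
  ((ContinuousLinearMap.compL ℂ E F G).analyticAt_bilinear (f z, g z)).comp₂ hf hg

namespace IsSymmetricFamily

theorem symm_zero (hT : IsSymmetricFamily T J) : IsSymmetricAlong (J 0) (T 0) := by
  simpa only [Complex.ofReal_zero] using hT.symm.self_of_nhds

theorem sub_smul_one (hT : IsSymmetricFamily T J) (hc : AnalyticAt ℂ c 0)
    (hreal : ∀ᶠ t : ℝ in 𝓝 0, starRingEnd ℂ (c t) = c t) :
    IsSymmetricFamily (fun z => T z - c z • 1) J where
  analytic := hT.analytic.sub (hc.smul analyticAt_const)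
  analytic_embedding := hT.analytic_embedding
  injective := hT.injective
  symm := by
    filter_upwards [hT.symm, hreal] with t ht hct using ht.sub_smul_one hct

theorem of_pow_smul (hT : IsSymmetricFamily T J) {m : ℕ} (hS : AnalyticAt ℂ S 0)
    (h : ∀ᶠ z in 𝓝 0, T z = z ^ m • S z) : IsSymmetricFamily S J := by
  have hne : ∀ᶠ t : ℝ in 𝓝[≠] 0, IsSymmetricAlong (J t) (S t) := by
    filter_upwards [nhdsWithin_le_nhds hT.symm,
      nhdsWithin_le_nhds (tendsto_ofReal_nhds_zero.eventually h), self_mem_nhdsWithin]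
      with t hsymm hTS ht
    refine .of_smul (c := (t : ℂ) ^ m) (by simp) (pow_ne_zero _ (Complex.ofReal_ne_zero.2 ht)) ?_
    rwa [← hTS]
  have h0 : IsSymmetricAlong (J 0) (S 0) :=
    have h𝓝 := tendsto_ofReal_nhds_zero.mono_left (nhdsWithin_le_nhds (s := {0}ᶜ))
    .of_tendsto (hT.analytic_embedding.continuousAt.tendsto.comp h𝓝)
      (hS.continuousAt.tendsto.comp h𝓝) hne
  refine ⟨hS, hT.analytic_embedding, hT.injective, ?_⟩
  filter_upwards [eventually_nhdsWithin_iff.1 hne] with t ht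
  rcases eq_or_ne t 0 with rfl | ht₀
  · simpa only [Complex.ofReal_zero] using h0
  · exact ht ht₀

theorem compression (hT : IsSymmetricFamily T J) (hU : AnalyticAt ℂ U 0) (hU₀ : U 0 = 1)
    (hD : AnalyticAt ℂ D 0) (hTU : ∀ᶠ z in 𝓝 0, T z * U z = U z * D z) {p q : Submodule ℂ V}
    (h : p.IsTopCompl q) (hcomm : ∀ z, Commute (p.projectionL q h) (D z)) :
    IsSymmetricFamily (fun z => compression h (D z)) (fun z => J z ∘L U z ∘L p.subtypeL) where
  analytic := analyticAt_clm_comp analyticAt_const (analyticAt_clm_comp hD analyticAt_const)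
  analytic_embedding :=
    analyticAt_clm_comp hT.analytic_embedding (analyticAt_clm_comp hU analyticAt_const)
  injective x y hxy := by simpa [hU₀, hT.injective.eq_iff] using hxy
  symm := by
    filter_upwards [hT.symm, tendsto_ofReal_nhds_zero.eventually hTU] with t ht hTUt u v
    have hUD : ∀ x, U t (D t x) = T t (U t x) := DFunLike.congr_fun hTUt.symm
    simpa [coe_compression_apply h (hcomm t), hUD] using ht (U t u) (U t v)

variable [FiniteDimensional ℂ V]

theorem eventually_conj_meanTrace (hT : IsSymmetricFamily T J) :
    ∀ᶠ t : ℝ in 𝓝 0, starRingEnd ℂ (meanTrace V (T t)) = meanTrace V (T t) := by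
  have hinj : ∀ᶠ z in 𝓝 0, Function.Injective (J z) :=
    hT.analytic_embedding.continuousAt.eventually
      (ContinuousLinearMap.isOpen_injective.mem_nhds hT.injective)
  filter_upwards [hT.symm, tendsto_ofReal_nhds_zero.eventually hinj] with t ht hJt
  exact conj_meanTrace ht hJt

/-- Subtracting the mean trace makes the family traceless, so that its leading coefficient is a
nonscalar operator. -/
theorem exists_eq_smul_one_add_pow_smul (hT : IsSymmetricFamily T J)
    (hne : ∀ c : ℂ → ℂ, AnalyticAt ℂ c 0 → ¬ ∀ᶠ z in 𝓝 0, T z = c z • 1) :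
    ∃ (c : ℂ → ℂ) (m : ℕ) (S : ℂ → V →L[ℂ] V), AnalyticAt ℂ c 0 ∧ IsSymmetricFamily S J ∧
      (∀ μ : ℂ, S 0 ≠ μ • 1) ∧ ∀ᶠ z in 𝓝 0, T z = c z • 1 + z ^ m • S z := by
  set c : ℂ → ℂ := fun z => meanTrace V (T z)
  have hcan : AnalyticAt ℂ c 0 := ((meanTrace V).analyticAt _).fun_comp hT.analytic
  have hS := hT.sub_smul_one hcan hT.eventually_conj_meanTrace
  have hS₀ : ¬ ∀ᶠ z in 𝓝 0, T z - c z • 1 = 0 := fun h =>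
    hne c hcan (h.mono fun z hz => sub_eq_zero.1 hz)
  have : Nontrivial V := by
    by_contra hV
    rw [not_nontrivial_iff_subsingleton] at hV
    exact hS₀ (.of_forall fun z => Subsingleton.elim _ _)
  obtain ⟨m, S₁, hS₁, hS₁0, hSS₁⟩ :=
    hS.analytic.exists_eventuallyEq_pow_smul_nonzero_iff.2 hS₀
  simp only [sub_zero] at hSS₁
  have htr : ∀ᶠ z in 𝓝[≠] 0, meanTrace V (S₁ z) = 0 := by
    filter_upwards [nhdsWithin_le_nhds hSS₁, self_mem_nhdsWithin] with z hz hz₀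
    have h0 : z ^ m * meanTrace V (S₁ z) = 0 := by
      rw [← smul_eq_mul, ← map_smul, ← hz, map_sub, map_smul, meanTrace_one, smul_eq_mul, mul_one,
        sub_self]
    exact (mul_eq_zero.1 h0).resolve_left (pow_ne_zero _ hz₀)
  have htr₀ : meanTrace V (S₁ 0) = 0 :=
    tendsto_nhds_unique_of_eventuallyEq
      (((meanTrace V).continuous.continuousAt.comp' hS₁.continuousAt).tendsto.mono_left
        nhdsWithin_le_nhds) tendsto_const_nhds htr
  exact ⟨c, m, S₁, hcan, hS.of_pow_smul hS₁ hSS₁, ne_smul_one_of_meanTrace_eq_zero hS₁0 htr₀,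
    hSS₁.mono fun z hz => by rw [← hz, add_sub_cancel]⟩

end IsSymmetricFamily

theorem IsSymmetricAlong.exists_isTopCompl [FiniteDimensional ℂ V] {J : V →L[ℂ] H} {A : V →L[ℂ] V}
    (hA : IsSymmetricAlong J A) (hJ : Function.Injective J) (hns : ∀ μ : ℂ, A ≠ μ • 1) :
    ∃ (p q : Submodule ℂ V) (h : p.IsTopCompl q), p ≠ ⊤ ∧ q ≠ ⊤ ∧
      ∀ X, Commute A X → Commute (p.projectionL q h) X := by
  have : Nontrivial V := by
    by_contra hV
    rw [not_nontrivial_iff_subsingleton] at hV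
    exact hns 0 (Subsingleton.elim _ _)
  obtain ⟨μ, hμ⟩ := Module.End.exists_eigenvalue A.toLinearMap
  obtain ⟨v, hv⟩ := hμ.exists_hasEigenvector
  have hvker : v ∈ (A - μ • 1).ker := by simpa [sub_eq_zero] using hv.apply_eq_smul
  have hcompl := (hA.sub_smul_one (hA.conj_eigenvalue hJ hv.2 hv.apply_eq_smul)).isCompl_ker_range
    hJ
  refine ⟨_, _, Submodule.IsCompl.isTopCompl_of_isClosed_of_finiteDimensional hcompl
    (Submodule.closed_of_finiteDimensional _), fun htop => hns μ ?_, fun htop => hv.2 ?_,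
    fun X hX => commute_projectionL_ker_range _
      (hX.sub_left ((Commute.one_left X).smul_left μ))⟩
  · ext x
    simpa [sub_eq_zero] using htop.ge (Submodule.mem_top (x := x))
  · exact Submodule.disjoint_def.1 hcompl.disjoint v hvker (htop.ge Submodule.mem_top)

namespace HasAnalyticEigenbasis

theorem of_smul_one_add_smul {a : ℂ → ℂ} (hS : HasAnalyticEigenbasis S)
    (ha : AnalyticAt ℂ a 0) (hc : AnalyticAt ℂ c 0)
    (h : ∀ᶠ z in 𝓝 0, T z = c z • 1 + a z • S z) : HasAnalyticEigenbasis T := by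
  obtain ⟨ι, _, b, e, l, he, hl, heb, heig⟩ := hS
  refine ⟨ι, inferInstance, b, e, fun j z => c z + a z * l j z, he,
    fun j => hc.add (ha.mul (hl j)), heb, ?_⟩
  filter_upwards [h, heig] with z hz heigz j
  simp [hz, heigz j, add_smul, mul_smul]

theorem of_smul_one [FiniteDimensional ℂ V] (hc : AnalyticAt ℂ c 0)
    (h : ∀ᶠ z in 𝓝 0, T z = c z • 1) : HasAnalyticEigenbasis T :=
  ⟨_, inferInstance, Module.finBasis ℂ V, fun j _ => Module.finBasis ℂ V j, fun _ => c,
    fun _ => analyticAt_const, fun _ => hc, fun _ => rfl, h.mono fun z hz j => by simp [hz]⟩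

theorem of_isTopCompl {p q : Submodule ℂ V} (h : p.IsTopCompl q) (hU : AnalyticAt ℂ U 0)
    (hU₀ : U 0 = 1) (hTU : ∀ᶠ z in 𝓝 0, T z * U z = U z * D z)
    (hcomm : ∀ z, Commute (p.projectionL q h) (D z))
    (hp : HasAnalyticEigenbasis fun z => compression h (D z))
    (hq : HasAnalyticEigenbasis fun z => compression h.symm (D z)) :
    HasAnalyticEigenbasis T := by
  obtain ⟨ι₁, _, b₁, e₁, l₁, he₁, hl₁, heb₁, heig₁⟩ := hp
  obtain ⟨ι₂, _, b₂, e₂, l₂, he₂, hl₂, heb₂, heig₂⟩ := hq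
  refine ⟨ι₁ ⊕ ι₂, inferInstance,
    (b₁.prod b₂).map (Submodule.prodEquivOfIsCompl p q h.isCompl),
    Sum.elim (fun j z => U z (e₁ j z)) (fun j z => U z (e₂ j z)), Sum.elim l₁ l₂,
    ?_, Sum.rec hl₁ hl₂,
    Sum.rec (fun j => by simp [hU₀, heb₁]) (fun j => by simp [hU₀, heb₂]), ?_⟩
  · rintro (j | j)
    · exact analyticAt_clm_apply hU ((p.subtypeL.analyticAt _).fun_comp (he₁ j))
    · exact analyticAt_clm_apply hU ((q.subtypeL.analyticAt _).fun_comp (he₂ j))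
  filter_upwards [hTU, heig₁, heig₂] with z hTUz h₁ h₂
  have hUD : ∀ x, T z (U z x) = U z (D z x) := DFunLike.congr_fun hTUz
  rintro (j | j)
  · rw [Sum.elim_inl, Sum.elim_inl, hUD, ← coe_compression_apply h (hcomm z), h₁ j,
      Submodule.coe_smul, map_smul]
  · rw [Sum.elim_inr, Sum.elim_inr, hUD,
      ← coe_compression_apply h.symm (commute_projectionL_symm (hcomm z)), h₂ j,
      Submodule.coe_smul, map_smul]

end HasAnalyticEigenbasis

theorem IsSymmetricFamily.hasAnalyticEigenbasis [FiniteDimensional ℂ V]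
    (hT : IsSymmetricFamily T J) : HasAnalyticEigenbasis T := by
  induction hd : Module.finrank ℂ V using Nat.strong_induction_on generalizing V with
  | _ d ih =>
  subst hd
  by_cases hscalar : ∃ c : ℂ → ℂ, AnalyticAt ℂ c 0 ∧ ∀ᶠ z in 𝓝 0, T z = c z • 1
  · obtain ⟨c, hc, hTc⟩ := hscalar
    exact .of_smul_one hc hTc
  obtain ⟨c, m, S, hc, hS, hns, hTS⟩ := hT.exists_eq_smul_one_add_pow_smul fun c hc h =>
    hscalar ⟨c, hc, h⟩
  refine .of_smul_one_add_smul ?_ (by fun_prop) hc hTS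
  obtain ⟨p, q, h, hp, hq, hcomm⟩ := hS.symm_zero.exists_isTopCompl hS.injective hns
  obtain ⟨U, D, hU, hD, hU₀, hSU, hPD⟩ := exists_analytic_block_diagonalization hS.analytic
    (Submodule.isIdempotentElem_projectionL h) hcomm
  exact .of_isTopCompl h hU hU₀ hSU hPD
    (ih _ (Submodule.finrank_lt hp) (hS.compression hU hU₀ hD hSU h hPD) rfl)
    (ih _ (Submodule.finrank_lt hq)
      (hS.compression hU hU₀ hD hSU h.symm fun z => commute_projectionL_symm (hPD z)) rfl)

end Rellich

section ConstOrStrict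

variable {α : Type*} [Preorder α] {l : Filter ℝ} {f g : ℝ → α}

/-- On some set of the filter `l`, the function `f` is constant or strictly monotone. -/
def ConstOrStrictNear (l : Filter ℝ) (f : ℝ → α) : Prop :=
  ∃ s ∈ l, (∃ c, EqOn f (fun _ => c) s) ∨ StrictMonoOn f s ∨ StrictAntiOn f s

namespace ConstOrStrictNear

theorem of_eventually_eq {c : α} (h : ∀ᶠ x in l, f x = c) : ConstOrStrictNear l f :=
  ⟨_, h, .inl ⟨c, fun _ hx => hx⟩⟩

theorem congr (hf : ConstOrStrictNear l f) (h : f =ᶠ[l] g) : ConstOrStrictNear l g := by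
  obtain ⟨s, hs, hfs⟩ := hf
  have heq : EqOn f g (s ∩ {x | f x = g x}) := fun x hx => hx.2
  refine ⟨_, inter_mem hs h, hfs.imp ?_ (.imp ?_ ?_)⟩
  · rintro ⟨c, hc⟩
    exact ⟨c, heq.symm.trans (hc.mono inter_subset_left)⟩
  · exact fun hmono => (hmono.mono inter_subset_left).congr heq
  · exact fun hanti => (hanti.mono inter_subset_left).congr heq

theorem comp_strictMonoOn {γ : Type*} [Preorder γ] {φ : α → γ} {t : Set α}
    (hf : ConstOrStrictNear l f) (hφ : StrictMonoOn φ t) (ht : ∀ᶠ x in l, f x ∈ t) :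
    ConstOrStrictNear l (φ ∘ f) := by
  obtain ⟨s, hs, hfs⟩ := hf
  have hmaps : MapsTo f (s ∩ {x | f x ∈ t}) t := fun x hx => hx.2
  refine ⟨_, inter_mem hs ht, hfs.imp ?_ (.imp ?_ ?_)⟩
  · rintro ⟨c, hc⟩
    exact ⟨φ c, fun x hx => congrArg φ (hc hx.1)⟩
  · exact fun hmono => hφ.comp (hmono.mono inter_subset_left) hmaps
  · exact fun hanti => hφ.comp_strictAntiOn (hanti.mono inter_subset_left) hmaps

theorem comp_inv (hf : ConstOrStrictNear (𝓝[>] 0) f) :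
    ConstOrStrictNear atTop fun β => f β⁻¹ := by
  obtain ⟨s, hs, hfs⟩ := hf
  have hanti : StrictAntiOn (fun β : ℝ => β⁻¹) (Ioi 0 ∩ (fun β => β⁻¹) ⁻¹' s) :=
    fun x hx y _ hxy => inv_strictAnti₀ hx.1 hxy
  have hmaps : MapsTo (fun β : ℝ => β⁻¹) (Ioi 0 ∩ (fun β => β⁻¹) ⁻¹' s) s := fun x hx => hx.2
  refine ⟨_, inter_mem (Ioi_mem_atTop 0) (tendsto_inv_atTop_nhdsGT_zero hs), hfs.imp ?_ fun h => ?_⟩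
  · rintro ⟨c, hc⟩
    exact ⟨c, fun x hx => hc hx.2⟩
  · exact h.symm.imp (fun h => h.comp hanti hmaps) fun h => h.comp_strictAntiOn hanti hmaps

theorem decreasesToZero {f : ℝ → ℝ≥0∞} (hf : ConstOrStrictNear atTop f)
    (hlim : Tendsto f atTop (𝓝 0)) : DecreasesToZero f := by
  refine ⟨?_, hlim⟩
  obtain ⟨s, hs, hfs⟩ := hf
  obtain ⟨b, hb⟩ := mem_atTop_sets.1 hs
  refine ⟨b, ?_⟩
  rcases hfs with ⟨c, hc⟩ | h | h
  · obtain rfl : c = 0 := tendsto_nhds_unique_of_eventuallyEq tendsto_const_nhds hlim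
      (eventually_atTop.2 ⟨b, fun β hβ => (hc (hb β hβ)).symm⟩)
    exact .inl fun β hβ => hc (hb β hβ)
  · have hlt : f b < f (b + 1) := h (hb _ le_rfl) (hb _ (by simp)) (by simp)
    have hle : f (b + 1) ≤ 0 := ge_of_tendsto hlim (eventually_atTop.2 ⟨b + 1, fun x hx =>
      h.monotoneOn (hb _ (by simp)) (hb _ (by linarith)) hx⟩)
    exact absurd (hlt.trans_le hle) not_lt_zero
  · exact .inr (h.mono hb)

theorem increasesToTop {f : ℝ → ℝ≥0∞} (hf : ConstOrStrictNear atTop f)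
    (hlim : Tendsto f atTop (𝓝 ⊤)) : IncreasesToTop f := by
  refine ⟨?_, hlim⟩
  obtain ⟨s, hs, hfs⟩ := hf
  obtain ⟨b, hb⟩ := mem_atTop_sets.1 hs
  refine ⟨b, ?_⟩
  rcases hfs with ⟨c, hc⟩ | h | h
  · obtain rfl : c = ⊤ := tendsto_nhds_unique_of_eventuallyEq tendsto_const_nhds hlim
      (eventually_atTop.2 ⟨b, fun β hβ => (hc (hb β hβ)).symm⟩)
    exact .inl fun β hβ => hc (hb β hβ)
  · exact .inr (h.mono hb)
  · have hlt : f (b + 1) < f b := h (hb _ le_rfl) (hb _ (by simp)) (by simp)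
    have hle : ⊤ ≤ f (b + 1) := le_of_tendsto hlim (eventually_atTop.2 ⟨b + 1, fun x hx =>
      h.antitoneOn (hb _ (by simp)) (hb _ (by linarith)) hx⟩)
    exact absurd (hle.trans_lt hlt) not_top_lt

end ConstOrStrictNear

end ConstOrStrict

section RealAnalyticGerms

variable {f s : ℝ → ℝ}

theorem analyticAt_eventually_sign (hf : AnalyticAt ℝ f 0) :
    (∀ᶠ x in 𝓝[>] 0, f x = 0) ∨ (∀ᶠ x in 𝓝[>] 0, 0 < f x) ∨ ∀ᶠ x in 𝓝[>] 0, f x < 0 := by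
  by_cases h : ∀ᶠ x in 𝓝 0, f x = 0
  · exact .inl (nhdsWithin_le_nhds h)
  obtain ⟨n, g, hg, hg0, hfg⟩ := hf.exists_eventuallyEq_pow_smul_nonzero_iff.2 h
  refine .inr (hg0.lt_or_gt.symm.imp (fun h0 => ?_) fun h0 => ?_)
  · filter_upwards [nhdsWithin_le_nhds hfg, self_mem_nhdsWithin,
      nhdsWithin_le_nhds (hg.continuousAt.eventually (lt_mem_nhds h0))] with x hfx hx hgx
    rw [hfx, sub_zero]
    exact smul_pos (pow_pos hx n) hgx
  · filter_upwards [nhdsWithin_le_nhds hfg, self_mem_nhdsWithin,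
      nhdsWithin_le_nhds (hg.continuousAt.eventually (gt_mem_nhds h0))] with x hfx hx hgx
    rw [hfx, sub_zero]
    exact mul_neg_of_pos_of_neg (pow_pos hx n) hgx

theorem exists_analyticAt_eventuallyEq_abs (hf : AnalyticAt ℝ f 0) :
    ∃ a : ℝ → ℝ, AnalyticAt ℝ a 0 ∧ ∀ᶠ x in 𝓝[>] 0, |f x| = a x := by
  rcases analyticAt_eventually_sign hf with h | h | h
  · exact ⟨_, hf, h.mono fun x hx => by rw [hx, abs_zero]⟩
  · exact ⟨_, hf, h.mono fun x hx => abs_of_pos hx⟩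
  · exact ⟨_, hf.neg, h.mono fun x hx => abs_of_neg hx⟩

theorem constOrStrictNear_of_analyticAt_deriv {W d : ℝ → ℝ} (hW : AnalyticAt ℝ W 0)
    (hd : ∀ᶠ x in 𝓝[>] 0, 0 < d x) (hf : ∀ᶠ x in 𝓝[>] 0, HasDerivAt f (W x / d x) x) :
    ConstOrStrictNear (𝓝[>] 0) f := by
  rcases analyticAt_eventually_sign hW with h | h | h <;>
    obtain ⟨δ, hδ, H⟩ := mem_nhdsGT_iff_exists_Ioo_subset.1 (hd.and (hf.and h)) <;>
    refine ⟨_, Ioo_mem_nhdsGT hδ, ?_⟩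
  · have hδ₂ : δ / 2 ∈ Ioo 0 δ := ⟨half_pos hδ, half_lt_self hδ⟩
    refine .inl ⟨f (δ / 2), fun x hx => isOpen_Ioo.is_const_of_deriv_eq_zero isPreconnected_Ioo
      (fun y hy => (H hy).2.1.differentiableAt.differentiableWithinAt) (fun y hy => ?_) hx hδ₂⟩
    rw [(H hy).2.1.deriv, (H hy).2.2, zero_div, Pi.zero_apply]
  · refine .inr (.inl (strictMonoOn_of_hasDerivWithinAt_pos (convex_Ioo _ _)
      (fun y hy => (H hy).2.1.continuousAt.continuousWithinAt)
      (fun y hy => (H (interior_subset hy)).2.1.hasDerivWithinAt) fun y hy => ?_))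
    exact div_pos (H (interior_subset hy)).2.2 (H (interior_subset hy)).1
  · refine .inr (.inr (strictAntiOn_of_hasDerivWithinAt_neg (convex_Ioo _ _)
      (fun y hy => (H hy).2.1.continuousAt.continuousWithinAt)
      (fun y hy => (H (interior_subset hy)).2.1.hasDerivWithinAt) fun y hy => ?_))
    exact div_neg_of_neg_of_pos (H (interior_subset hy)).2.2 (H (interior_subset hy)).1

theorem constOrStrictNear_div (hf : AnalyticAt ℝ f 0) (hs : AnalyticAt ℝ s 0)
    (hs₀ : ∀ᶠ x in 𝓝[>] 0, 0 < s x) : ConstOrStrictNear (𝓝[>] 0) fun x => f x / s x := by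
  refine constOrStrictNear_of_analyticAt_deriv ((hf.deriv.mul hs).sub (hf.mul hs.deriv))
    (hs₀.mono fun x hx => pow_pos hx 2) ?_
  filter_upwards [hs₀, nhdsWithin_le_nhds hf.eventually_analyticAt,
    nhdsWithin_le_nhds hs.eventually_analyticAt] with x hx hfx hsx
  exact hfx.differentiableAt.hasDerivAt.div hsx.differentiableAt.hasDerivAt hx.ne'

theorem analyticAt_comp_ofReal {h : ℂ → ℂ} (hh : AnalyticAt ℂ h 0) :
    AnalyticAt ℝ (fun x : ℝ => h x) 0 :=
  AnalyticAt.fun_comp (g := h) (by simpa using hh.restrictScalars) (Complex.ofRealCLM.analyticAt 0)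

end RealAnalyticGerms

section QualityFactor

/-- In `ℝ≥0∞`, where `x / 0 = ⊤` for `x ≠ 0` and `0 / 0 = 0`, the three cases of the quality factor
are given by one quotient. -/
theorem qFactor_eq_div {ζ : ℂ} (h : ζ.im ≤ 0) :
    qFactor ζ = ENNReal.ofReal |ζ.re| / ENNReal.ofReal (2 * -ζ.im) := by
  rw [qFactor]
  split_ifs with h0 him
  · simp [h0]
  · have hre : ζ.re ≠ 0 := fun hre => h0 (Complex.ext hre him)
    simp [him, ENNReal.div_zero, hre]
  · have him' : 0 < -ζ.im := neg_pos.2 (lt_of_le_of_ne h him)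
    rw [← ENNReal.ofReal_div_of_pos (by positivity)]
    congr 1
    field_simp

theorem qFactor_ofReal_mul {c : ℝ} (hc : 0 < c) (ζ : ℂ) : qFactor (c * ζ) = qFactor ζ := by
  simp only [qFactor, mul_eq_zero, Complex.ofReal_eq_zero, hc.ne', false_or, Complex.im_ofReal_mul,
    Complex.re_ofReal_mul, abs_mul, abs_of_pos hc, ← mul_neg, mul_div_mul_left _ _ hc.ne']

theorem qFactor_ofReal {ρ : ℝ} (hρ : ρ ≠ 0) : qFactor ρ = ⊤ := by
  simp [qFactor, hρ]

theorem qFactor_of_re_eq_zero {ζ : ℂ} (h : ζ.re = 0) : qFactor ζ = 0 := by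
  have him : ζ ≠ 0 → ζ.im ≠ 0 := fun h0 him => h0 (Complex.ext h him)
  rw [qFactor]
  split_ifs with h0 h1
  · rfl
  · exact absurd h1 (him h0)
  · simp [h]

variable {ι : Type*} {l : Filter ι} {ζ : ι → ℂ}

theorem tendsto_qFactor [l.NeBot] {ζ₀ : ℂ} (hζ₀ : ζ₀ ≠ 0) (him : ∀ᶠ i in l, (ζ i).im ≤ 0)
    (h : Tendsto ζ l (𝓝 ζ₀)) : Tendsto (fun i => qFactor (ζ i)) l (𝓝 (qFactor ζ₀)) := by
  have him_lim := (Complex.continuous_im.tendsto _).comp h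
  have him₀ : ζ₀.im ≤ 0 := le_of_tendsto him_lim him
  have hre_lim := ((Complex.continuous_re.tendsto _).comp h).abs
  rw [qFactor_eq_div him₀]
  refine (ENNReal.Tendsto.div (ENNReal.tendsto_ofReal hre_lim) ?_
    (ENNReal.tendsto_ofReal (him_lim.neg.const_mul 2)) (.inl ENNReal.ofReal_ne_top)).congr'
      (him.mono fun i hi => (qFactor_eq_div hi).symm)
  contrapose! hζ₀
  simp only [ENNReal.ofReal_eq_zero] at hζ₀
  exact Complex.ext (abs_nonpos_iff.1 hζ₀.1) (by rw [Complex.zero_im]; linarith [hζ₀.2])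

theorem tendsto_qFactor_zero_of_norm_tendsto_atTop {C : ℝ} (him : ∀ᶠ i in l, (ζ i).im ≤ 0)
    (hre : ∀ᶠ i in l, |(ζ i).re| ≤ C) (h : Tendsto (fun i => ‖ζ i‖) l atTop) :
    Tendsto (fun i => qFactor (ζ i)) l (𝓝 0) := by
  have him_lim : Tendsto (fun i => 2 * -(ζ i).im) l atTop := by
    refine (tendsto_atTop_mono' l ?_ (tendsto_atTop_add_const_right l (-C) h)).const_mul_atTop
      two_pos
    filter_upwards [him, hre] with i hi hri
    linarith [Complex.norm_le_abs_re_add_abs_im (ζ i), abs_of_nonpos hi]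
  have hbound : Tendsto (fun i => ENNReal.ofReal C / ENNReal.ofReal (2 * -(ζ i).im)) l (𝓝 0) := by
    simpa using ENNReal.Tendsto.const_div (ENNReal.tendsto_ofReal_nhds_top.2 him_lim)
      (.inr (ENNReal.ofReal_ne_top (r := C)))
  refine tendsto_of_tendsto_of_tendsto_of_le_of_le' tendsto_const_nhds hbound (.of_forall fun _ =>
    zero_le) ?_
  filter_upwards [him, hre] with i hi hri
  rw [qFactor_eq_div hi]
  gcongr

theorem constOrStrictNear_qFactor {h : ℂ → ℂ} (hh : AnalyticAt ℂ h 0)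
    (him : ∀ᶠ x : ℝ in 𝓝[>] 0, (h x).im ≤ 0) :
    ConstOrStrictNear (𝓝[>] 0) fun x : ℝ => qFactor (h x) := by
  have hre : AnalyticAt ℝ (fun x : ℝ => (h x).re) 0 :=
    (Complex.reCLM.analyticAt _).fun_comp (analyticAt_comp_ofReal hh)
  have hs : AnalyticAt ℝ (fun x : ℝ => 2 * -(h x).im) 0 :=
    analyticAt_const.mul ((Complex.imCLM.analyticAt _).fun_comp (analyticAt_comp_ofReal hh)).neg
  obtain ⟨a, ha, habs⟩ := exists_analyticAt_eventuallyEq_abs hre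
  have hq : ∀ᶠ x : ℝ in 𝓝[>] 0, qFactor (h x) = ENNReal.ofReal (a x)
      / ENNReal.ofReal (2 * -(h x).im) := by
    filter_upwards [him, habs] with x hx hax
    rw [qFactor_eq_div hx, hax]
  rcases analyticAt_eventually_sign hs with hs₀ | hs₀ | hs₀
  · rcases analyticAt_eventually_sign ha with ha₀ | ha₀ | ha₀
    · exact .of_eventually_eq (c := 0) (by filter_upwards [hq, ha₀] with x hx hax; simp [hx, hax])
    · refine .of_eventually_eq (c := ⊤) ?_
      filter_upwards [hq, ha₀, hs₀] with x hx hax hsx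
      simp [hx, hsx, ENNReal.div_zero, hax]
    · obtain ⟨x, hx, hax⟩ := (ha₀.and habs).exists
      exact absurd (abs_nonneg _) (hax ▸ hx.not_ge)
  · refine ((constOrStrictNear_div ha hs hs₀).comp_strictMonoOn (φ := ENNReal.ofReal) (t := Ici 0)
      (fun x hx y _ hxy => (ENNReal.ofReal_lt_ofReal_iff (hx.trans_lt hxy)).2 hxy) ?_).congr ?_
    · filter_upwards [habs, hs₀] with x hx hsx using div_nonneg (hx ▸ abs_nonneg _) hsx.le
    · filter_upwards [hq, hs₀] with x hx hsx using
        (ENNReal.ofReal_div_of_pos hsx).trans hx.symm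
  · obtain ⟨x, hx, hsx⟩ := (him.and hs₀).exists
    linarith

theorem constOrStrictNear_qFactor_atTop {ζ : ℝ → ℂ} {h : ℂ → ℂ} {n : ℕ} (hh : AnalyticAt ℂ h 0)
    (hζ : ∀ᶠ β : ℝ in atTop, ζ β = (β : ℂ) ^ n * h (β : ℂ)⁻¹)
    (him : ∀ᶠ β in atTop, (ζ β).im ≤ 0) : ConstOrStrictNear atTop fun β => qFactor (ζ β) := by
  have hζ' : ∀ᶠ β : ℝ in atTop, 0 < β ^ n ∧ ζ β = (β ^ n : ℝ) * h (β⁻¹ : ℝ) := by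
    filter_upwards [hζ, eventually_gt_atTop 0] with β hβ hβ₀
    exact ⟨pow_pos hβ₀ n, by rw [hβ, Complex.ofReal_pow, Complex.ofReal_inv]⟩
  refine (constOrStrictNear_qFactor hh ?_).comp_inv.congr ?_
  · have him' : ∀ᶠ β : ℝ in atTop, (h (β⁻¹ : ℝ)).im ≤ 0 := by
      filter_upwards [hζ', him] with β hβ hi
      rw [hβ.2, Complex.im_ofReal_mul] at hi
      exact nonpos_of_mul_nonpos_right hi hβ.1
    filter_upwards [tendsto_inv_nhdsGT_zero.eventually him'] with x hx
    rwa [inv_inv] at hx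
  · filter_upwards [hζ'] with β hβ
    rw [hβ.2, qFactor_ofReal_mul hβ.1]

end QualityFactor

section GermsAtInfinity

theorem tendsto_inv_ofReal_atTop : Tendsto (fun β : ℝ => (β : ℂ)⁻¹) atTop (𝓝[≠] 0) := by
  refine tendsto_nhdsWithin_iff.2 ⟨?_, ?_⟩
  · exact (tendsto_ofReal_nhds_zero.comp tendsto_inv_atTop_zero).congr fun β => by simp
  · filter_upwards [eventually_gt_atTop 0] with β hβ
    exact inv_ne_zero (Complex.ofReal_ne_zero.2 hβ.ne')

variable {E : Type*} [NormedAddCommGroup E] [NormedSpace ℂ E] {f : ℝ → E} {ζ : ℝ → ℂ}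

theorem analyticAt_dslope {g : ℂ → E} {z : ℂ} (hg : AnalyticAt ℂ g z) :
    AnalyticAt ℂ (dslope g z) z := by
  obtain ⟨p, hp⟩ := hg
  exact ⟨_, hp.has_fpower_series_dslope_fslope⟩

namespace AnalyticAtInfinity

theorem of_analyticAt {g : ℂ → E} (hg : AnalyticAt ℂ g 0)
    (hf : ∀ᶠ β : ℝ in atTop, f β = g (β : ℂ)⁻¹) {c : E} (hc : g 0 = c) :
    AnalyticAtInfinity f ∧ Tendsto f atTop (𝓝 c) :=
  ⟨⟨g, hg, hf⟩, (hc ▸ (hg.continuousAt.tendsto.mono_left nhdsWithin_le_nhds).comp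
    tendsto_inv_ofReal_atTop).congr' (hf.mono fun _ => Eq.symm)⟩

theorem clm_comp {F : Type*} [NormedAddCommGroup F] [NormedSpace ℂ F] (hf : AnalyticAtInfinity f)
    (T : E →L[ℂ] F) : AnalyticAtInfinity fun β => T (f β) := by
  obtain ⟨g, hg, hfg⟩ := hf
  exact ⟨fun z => T (g z), (T.analyticAt _).comp hg, hfg.mono fun β hβ => congrArg T hβ⟩

theorem exists_tendsto (hf : AnalyticAtInfinity f) : ∃ c, Tendsto f atTop (𝓝 c) := by
  obtain ⟨g, hg, hfg⟩ := hf
  exact ⟨_, (of_analyticAt hg hfg rfl).2⟩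

theorem exists_tendsto_smul (hf : AnalyticAtInfinity f) (h0 : Tendsto f atTop (𝓝 0)) :
    ∃ c, Tendsto (fun β : ℝ => (β : ℂ) • f β) atTop (𝓝 c) := by
  obtain ⟨g, hg, hfg⟩ := hf
  have hg0 : g 0 = 0 := tendsto_nhds_unique (of_analyticAt hg hfg rfl).2 h0
  refine ⟨_, (of_analyticAt (analyticAt_dslope hg) ?_ rfl).2⟩
  filter_upwards [hfg, eventually_gt_atTop 0] with β hβ hβ₀
  have hslope := sub_smul_dslope g 0 (β : ℂ)⁻¹
  rw [hg0, sub_zero, sub_zero] at hslope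
  rw [hβ, ← hslope, smul_inv_smul₀ (Complex.ofReal_ne_zero.2 hβ₀.ne')]

theorem exists_smul_tendsto_ne_zero (hf : AnalyticAtInfinity f) (hne : ∀ᶠ β in atTop, f β ≠ 0) :
    ∃ (v : ℝ → E) (v₀ : E), AnalyticAtInfinity v ∧ v₀ ≠ 0 ∧ Tendsto v atTop (𝓝 v₀) ∧
      ∀ᶠ β in atTop, ∃ c : ℂ, v β = c • f β := by
  obtain ⟨g, hg, hfg⟩ := hf
  have hg₀ : ¬ ∀ᶠ z in 𝓝 0, g z = 0 := fun h => by
    have hg_inv := (tendsto_inv_ofReal_atTop.mono_right nhdsWithin_le_nhds).eventually h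
    obtain ⟨β, hβ, hne', hz⟩ := (hfg.and (hne.and hg_inv)).exists
    exact hne' (hβ.trans hz)
  obtain ⟨m, v, hv, hv0, hgv⟩ := hg.exists_eventuallyEq_pow_smul_nonzero_iff.2 hg₀
  obtain ⟨hvan, hvlim⟩ := of_analyticAt hv (.of_forall fun _ => rfl) rfl
  refine ⟨_, _, hvan, hv0, hvlim, ?_⟩
  filter_upwards [hfg, (tendsto_inv_ofReal_atTop.mono_right nhdsWithin_le_nhds).eventually hgv,
    eventually_gt_atTop 0] with β hβ hβ' hβ₀
  have hpow : ((β : ℂ)⁻¹) ^ m ≠ 0 := pow_ne_zero _ (inv_ne_zero (Complex.ofReal_ne_zero.2 hβ₀.ne'))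
  exact ⟨(((β : ℂ)⁻¹) ^ m)⁻¹, by rw [hβ, hβ', sub_zero, inv_smul_smul₀ hpow]⟩

theorem exists_eq_pow_mul (h : AnalyticAtInfinity ζ) :
    ∃ (n : ℕ) (g : ℂ → ℂ), AnalyticAt ℂ g 0 ∧
      ∀ᶠ β : ℝ in atTop, ζ β = (β : ℂ) ^ n * g (β : ℂ)⁻¹ := by
  obtain ⟨g, hg, hζ⟩ := h
  exact ⟨0, g, hg, by simpa using hζ⟩

end AnalyticAtInfinity

namespace HasPoleAtInfinity

theorem exists_eq_pow_mul (h : HasPoleAtInfinity ζ) :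
    ∃ (n : ℕ) (g : ℂ → ℂ), AnalyticAt ℂ g 0 ∧
      ∀ᶠ β : ℝ in atTop, ζ β = (β : ℂ) ^ n * g (β : ℂ)⁻¹ := by
  obtain ⟨g, ⟨n, hg⟩, -, hζ⟩ := h
  refine ⟨n, _, hg, ?_⟩
  filter_upwards [hζ, eventually_gt_atTop 0] with β hβ hβ₀
  have hpow : (β : ℂ) ^ n ≠ 0 := pow_ne_zero _ (Complex.ofReal_ne_zero.2 hβ₀.ne')
  rw [hβ, sub_zero, smul_eq_mul, inv_pow, mul_inv_cancel_left₀ hpow]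

theorem tendsto_norm (h : HasPoleAtInfinity ζ) : Tendsto (fun β => ‖ζ β‖) atTop atTop := by
  obtain ⟨g, -, hord, hζ⟩ := h
  exact (tendsto_norm_cobounded_atTop.comp ((tendsto_cobounded_of_meromorphicOrderAt_neg hord).comp
    tendsto_inv_ofReal_atTop)).congr' (hζ.mono fun β hβ => by simp [hβ])

end HasPoleAtInfinity

end GermsAtInfinity

section PencilEigenvalues

variable {l : ℂ → ℂ}

/-- Since `Ω - iβB = -iβ (B + zΩ)` for `z = i/β`, this is the eigenvalue of `Ω - iβB` that belongs
to the eigenvalue `l z` of the pencil `B + zΩ`. -/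
noncomputable def pencilMode (l : ℂ → ℂ) (β : ℝ) : ℂ :=
  -(Complex.I * β) * l (Complex.I * (β : ℂ)⁻¹)

theorem analyticAt_comp_I_mul {E : Type*} [NormedAddCommGroup E] [NormedSpace ℂ E] {f : ℂ → E}
    (hf : AnalyticAt ℂ f 0) : AnalyticAt ℂ (fun z => f (Complex.I * z)) 0 :=
  AnalyticAt.fun_comp (g := f) (by simpa using hf) (analyticAt_const.mul analyticAt_id)

theorem hasPoleAtInfinity_pencilMode (hl : AnalyticAt ℂ l 0) (h0 : l 0 ≠ 0) :
    HasPoleAtInfinity (pencilMode l) := by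
  have han : AnalyticAt ℂ (fun z => -Complex.I * l (Complex.I * z)) 0 :=
    analyticAt_const.mul (analyticAt_comp_I_mul hl)
  have hmer : MeromorphicAt (fun z => z⁻¹ * (-Complex.I * l (Complex.I * z))) 0 :=
    (MeromorphicAt.id 0).inv.mul han.meromorphicAt
  have hord : meromorphicOrderAt (fun z => z⁻¹ * (-Complex.I * l (Complex.I * z))) 0 = (-1 : ℤ) :=
    (meromorphicOrderAt_eq_int_iff hmer).2 ⟨_, han, by simpa using h0, .of_forall fun z => by simp⟩
  refine ⟨_, hmer, ?_, .of_forall fun β => ?_⟩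
  · rw [hord]
    exact_mod_cast neg_one_lt_zero (R := ℤ)
  · simp only [pencilMode, inv_inv]
    ring

theorem pencilMode_of_apply_zero_eq_zero (hl : AnalyticAt ℂ l 0) (h0 : l 0 = 0) :
    AnalyticAtInfinity (pencilMode l) ∧ Tendsto (pencilMode l) atTop (𝓝 (deriv l 0)) := by
  refine AnalyticAtInfinity.of_analyticAt (analyticAt_comp_I_mul (analyticAt_dslope hl)) ?_
    (by rw [mul_zero, dslope_same])
  filter_upwards [eventually_gt_atTop 0] with β hβ
  have hslope := sub_smul_dslope l 0 (Complex.I * (β : ℂ)⁻¹)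
  rw [h0, sub_zero, sub_zero, smul_eq_mul] at hslope
  rw [pencilMode, ← hslope]
  linear_combination (exp := 1)
    -(dslope l 0 (Complex.I * (β : ℂ)⁻¹)) * (β : ℂ) * (β : ℂ)⁻¹ * Complex.I_mul_I
      + dslope l 0 (Complex.I * (β : ℂ)⁻¹) * mul_inv_cancel₀ (Complex.ofReal_ne_zero.2 hβ.ne')

end PencilEigenvalues

section Eigenbasis

variable {K W ι : Type*} [Field K] [AddCommGroup W] [Module K W]

variable {b : Module.Basis ι K W} {f Ω : W →ₗ[K] W} {l a : ι → K}

theorem repr_apply_eigenbasis (h : ∀ j, f (b j) = l j • b j) (u : W) (j : ι) :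
    b.repr (f u) j = l j * b.repr u j := by
  have hcoord : (b.coord j).comp f = l j • b.coord j := b.ext fun i => by
    obtain rfl | hij := eq_or_ne i j
    · simp [h]
    · simp [h, hij]
  exact LinearMap.congr_fun hcoord u

theorem mem_ker_iff_repr_eigenbasis (h : ∀ j, f (b j) = l j • b j) (u : W) :
    u ∈ f.ker ↔ ∀ j, b.repr u j ≠ 0 → l j = 0 := by
  rw [LinearMap.mem_ker, ← b.forall_coord_eq_zero_iff]
  simp only [b.coord_apply, repr_apply_eigenbasis h, mul_eq_zero, or_iff_not_imp_right, ne_eq]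

theorem repr_eq_zero_of_mem_range_eigenbasis (h : ∀ j, f (b j) = l j • b j) {x : W}
    (hx : x ∈ f.range) {j : ι} (hj : l j = 0) : b.repr x j = 0 := by
  obtain ⟨y, rfl⟩ := hx
  rw [repr_apply_eigenbasis h, hj, zero_mul]

theorem finrank_eq_natCard_of_mem_iff [Finite ι] (b : Module.Basis ι K W) {p : ι → Prop}
    {U : Submodule K W} (hU : ∀ u, u ∈ U ↔ ∀ j, b.repr u j ≠ 0 → p j) :
    Module.finrank K U = Nat.card {j // p j} := by
  classical
  have := Fintype.ofFinite ι
  have hspan : U = Submodule.span K (b '' {j | p j}) := by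
    ext u
    rw [hU, b.mem_span_image]
    exact forall_congr' fun j => by rw [Finset.mem_coe, Finsupp.mem_support_iff, mem_ofPred_eq]
  rw [hspan, Nat.card_eq_fintype_card, ← finrank_span_eq_card
    (b.linearIndependent.comp (Subtype.val : {j // p j} → ι) Subtype.val_injective), range_comp,
    Subtype.range_coe_subtype]

theorem natCard_eigenvalue_eq_zero [Finite ι] (h : ∀ j, f (b j) = l j • b j) :
    Nat.card {j // l j = 0} = Module.finrank K f.ker :=
  (finrank_eq_natCard_of_mem_iff b (mem_ker_iff_repr_eigenbasis h)).symm

/-- The kernel of the compression of `Ω` to `ker f`, when `ker f` and `range f` are complementary: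
the compression is `Ω` on `ker f` followed by the projection to `ker f` along `range f`. -/
def compressionKernel (f Ω : W →ₗ[K] W) : Submodule K W :=
  f.ker ⊓ f.range.comap Ω

theorem apply_sub_sum_mem_range [Fintype ι] (h : ∀ j, f (b j) = l j • b j)
    (ha : ∀ j, l j = 0 → Ω (b j) - a j • b j ∈ f.range) {u : W} (hu : u ∈ f.ker) :
    Ω u - ∑ j, (b.repr u j * a j) • b j ∈ f.range := by
  have hsum : Ω u - ∑ j, (b.repr u j * a j) • b j =
      ∑ j, b.repr u j • (Ω (b j) - a j • b j) := by
    conv_lhs => rw [← b.sum_repr u, map_sum, b.sum_repr u]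
    simp only [map_smul, mul_smul, smul_sub, Finset.sum_sub_distrib]
  rw [hsum]
  refine Submodule.sum_mem _ fun j _ => ?_
  by_cases hj : b.repr u j = 0
  · simp [hj]
  · exact Submodule.smul_mem _ _ (ha j ((mem_ker_iff_repr_eigenbasis h u).1 hu j hj))

theorem natCard_compression_eigenvalue_eq_zero [Finite ι] (h : ∀ j, f (b j) = l j • b j)
    (ha : ∀ j, l j = 0 → Ω (b j) - a j • b j ∈ f.range) :
    Nat.card {j // l j = 0 ∧ a j = 0} = Module.finrank K (compressionKernel f Ω) := by
  have := Fintype.ofFinite ι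
  refine (finrank_eq_natCard_of_mem_iff b fun u => ⟨?_, fun hu => ?_⟩).symm
  · rintro ⟨hu, hΩu : Ω u ∈ f.range⟩ j hj
    have hlj := (mem_ker_iff_repr_eigenbasis h u).1 hu j hj
    have hcoord := repr_eq_zero_of_mem_range_eigenbasis h
      ((Submodule.sub_mem_iff_right _ hΩu).1 (apply_sub_sum_mem_range h ha hu)) hlj
    rw [b.repr_sum_self] at hcoord
    exact ⟨hlj, (mul_eq_zero.1 hcoord).resolve_left hj⟩
  · have hker := (mem_ker_iff_repr_eigenbasis h u).2 fun j hj => (hu j hj).1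
    have hsum : ∑ j, (b.repr u j * a j) • b j = 0 := Finset.sum_eq_zero fun j _ => by
      rw [mul_eq_zero.2 (or_iff_not_imp_left.2 fun hj => (hu j hj).2), zero_smul]
    have hΩu := apply_sub_sum_mem_range h ha hker
    rw [hsum, sub_zero] at hΩu
    exact ⟨hker, hΩu⟩

theorem map_eigenvalues_eq_roots_charpoly [Fintype ι] [FiniteDimensional K W]
    (h : ∀ j, f (b j) = l j • b j) :
    Finset.univ.val.map l = f.charpoly.roots := by
  classical
  have hdiag : LinearMap.toMatrix b b f = Matrix.diagonal l := by
    ext i j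
    obtain rfl | hij := eq_or_ne i j
    · simp [LinearMap.toMatrix_apply, h]
    · simp [LinearMap.toMatrix_apply, h, hij]
  rw [← LinearMap.charpoly_toMatrix f b, hdiag, Matrix.charpoly_diagonal, Polynomial.roots_prod _ _
    (Finset.prod_ne_zero_iff.2 fun j _ => Polynomial.X_sub_C_ne_zero _)]
  simp only [Polynomial.roots_X_sub_C, Multiset.bind_singleton]

end Eigenbasis

theorem exists_equiv_fin_lt_natCard_iff {ι α : Type*} [Finite ι] [LinearOrder α] {n : ℕ}
    (hn : Nat.card ι = n) (key : ι → α) :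
    ∃ e : Fin n ≃ ι,
      ∀ (j : Fin n) (c : α), (j : ℕ) < Nat.card {i // key i ≤ c} ↔ key (e j) ≤ c := by
  obtain ⟨e⟩ : Nonempty (Fin n ≃ ι) := ⟨(Finite.equivFinOfCardEq hn).symm⟩
  let s := (Tuple.sort (key ∘ e)).trans e
  refine ⟨s, fun j c => ?_⟩
  have hcard : Nat.card {i // key i ≤ c} = Fintype.card {i // key (s i) ≤ c} := by
    rw [← Nat.card_eq_fintype_card]
    exact Nat.card_congr (s.subtypeEquiv fun _ => Iff.rfl).symm
  rw [hcard, Fintype.card_subtype]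
  exact Tuple.lt_card_le_iff_apply_le_of_monotone (Tuple.monotone_sort (key ∘ e))

section Pencil

variable {V H : Type*} [NormedAddCommGroup V] [NormedSpace ℂ V] [NormedAddCommGroup H]
  [InnerProductSpace ℂ H] {J : V →L[ℂ] H} {B Ω : V →L[ℂ] V}

theorem isSymmetricFamily_add_smul (hB : IsSymmetricAlong J B) (hΩ : IsSymmetricAlong J Ω)
    (hJ : Function.Injective J) : IsSymmetricFamily (fun z => B + z • Ω) (fun _ => J) where
  analytic := analyticAt_const.add (analyticAt_id.smul analyticAt_const)
  analytic_embedding := analyticAt_const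
  injective := hJ
  symm := .of_forall fun t u v => by simp [hB u v, hΩ u v]

theorem conj_eq_of_apply_sub_smul_mem_range (hB : IsSymmetricAlong J B)
    (hΩ : IsSymmetricAlong J Ω) (hJ : Function.Injective J) {v : V} (hv : v ≠ 0) (hBv : B v = 0)
    {c : ℂ} (hc : Ω v - c • v ∈ B.range) : starRingEnd ℂ c = c := by
  obtain ⟨u, hu : B u = Ω v - c • v⟩ := hc
  have hΩv : Ω v = B u + c • v := by rw [hu, sub_add_cancel]
  have hBu : inner ℂ (J (B u)) (J v) = 0 := by rw [hB, hBv, map_zero, inner_zero_right]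
  have hsymm := hΩ v v
  rw [hΩv, map_add, inner_add_left, inner_add_right, ← hB, hBu, hBv, map_zero, inner_zero_left,
    zero_add, zero_add, map_smul, inner_smul_left, inner_smul_right] at hsymm
  exact mul_right_cancel₀ (inner_self_ne_zero.2 ((map_ne_zero_iff J hJ).2 hv)) hsymm

theorem apply_deriv_add_apply_eq {e : ℂ → V} {l : ℂ → ℂ} (he : AnalyticAt ℂ e 0)
    (hl : AnalyticAt ℂ l 0) (h : ∀ᶠ z in 𝓝 0, (B + z • Ω) (e z) = l z • e z) (hl₀ : l 0 = 0) :
    B (deriv e 0) + Ω (e 0) = deriv l 0 • e 0 := by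
  have he' := he.differentiableAt.hasDerivAt
  have hB : HasDerivAt (fun z => B (e z)) (B (deriv e 0)) 0 :=
    B.hasFDerivAt.comp_hasDerivAt 0 he'
  have hΩ : HasDerivAt (fun z => Ω (e z)) (Ω (deriv e 0)) 0 :=
    Ω.hasFDerivAt.comp_hasDerivAt 0 he'
  have hleft : HasDerivAt (fun z => (B + z • Ω) (e z)) (B (deriv e 0) + Ω (e 0)) 0 := by
    simpa using hB.fun_add ((hasDerivAt_id (0 : ℂ)).fun_smul hΩ)
  have hright := (hl.differentiableAt.hasDerivAt.smul he').congr_of_eventuallyEq h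
  rw [hleft.unique hright, hl₀, zero_smul, zero_add]

/-- A family of modes of `Ω - iβB`, `β → ∞`, together with its limits: the eigenvectors `w j` tend
to an eigenbasis `b` of `B` with eigenvalues `μ`. The mode is high-loss if `μ j ≠ 0`; otherwise
`ζ j` has a finite limit `ρ j`, an eigenvalue of the compression of `Ω` to `ker B`. -/
structure IsPencilModeFamily {ι : Type*} (B Ω : V →L[ℂ] V) (b : Module.Basis ι ℂ V) (μ : ι → ℂ)
    (ρ : ι → ℝ) (ζ : ι → ℝ → ℂ) (w : ι → ℝ → V) : Prop where
  eigen : ∀ᶠ β : ℝ in atTop, ∀ j, (Ω - (Complex.I * β) • B) (w j β) = ζ j β • w j β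
  vec_analytic : ∀ j, AnalyticAtInfinity (w j)
  vec_tendsto : ∀ j, Tendsto (w j) atTop (𝓝 (b j))
  loss_eigen : ∀ j, B (b j) = μ j • b j
  high_loss : ∀ j, μ j ≠ 0 → HasPoleAtInfinity (ζ j)
  low_loss : ∀ j, μ j = 0 → AnalyticAtInfinity (ζ j)
  low_loss_tendsto : ∀ j, μ j = 0 → Tendsto (ζ j) atTop (𝓝 (ρ j))
  compression_eigen : ∀ j, μ j = 0 → Ω (b j) - (ρ j : ℂ) • b j ∈ B.range

namespace IsPencilModeFamily

variable {ι : Type*} {b : Module.Basis ι ℂ V} {μ : ι → ℂ} {ρ : ι → ℝ} {ζ : ι → ℝ → ℂ}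
  {w : ι → ℝ → V}

theorem eventually_linearIndependent [FiniteDimensional ℂ V] [Finite ι]
    (h : IsPencilModeFamily B Ω b μ ρ ζ w) :
    ∀ᶠ β : ℝ in atTop, LinearIndependent ℂ fun j => w j β :=
  (tendsto_pi_nhds.2 h.vec_tendsto).eventually
    (isOpen_setOfPred_linearIndependent.mem_nhds b.linearIndependent)

theorem comp_equiv {κ : Type*} (h : IsPencilModeFamily B Ω b μ ρ ζ w) (e : κ ≃ ι) :
    IsPencilModeFamily B Ω (b.reindex e.symm) (μ ∘ e) (ρ ∘ e) (ζ ∘ e) (w ∘ e) where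
  eigen := h.eigen.mono fun _ hβ j => hβ (e j)
  vec_analytic j := h.vec_analytic (e j)
  vec_tendsto j := by simpa using h.vec_tendsto (e j)
  loss_eigen j := by simpa using h.loss_eigen (e j)
  high_loss j := h.high_loss (e j)
  low_loss j := h.low_loss (e j)
  low_loss_tendsto j := h.low_loss_tendsto (e j)
  compression_eigen j := by simpa using h.compression_eigen (e j)

end IsPencilModeFamily

theorem eventually_pencilMode_eigen {ι : Type*} {e : ι → ℂ → V} {l : ι → ℂ → ℂ}
    (h : ∀ᶠ z in 𝓝 0, ∀ j, (B + z • Ω) (e j z) = l j z • e j z) :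
    ∀ᶠ β : ℝ in atTop, ∀ j, (Ω - (Complex.I * β) • B) (e j (Complex.I * (β : ℂ)⁻¹)) =
      pencilMode (l j) β • e j (Complex.I * (β : ℂ)⁻¹) := by
  have hz : Tendsto (fun β : ℝ => Complex.I * (β : ℂ)⁻¹) atTop (𝓝 0) := by
    simpa using (tendsto_inv_ofReal_atTop.mono_right nhdsWithin_le_nhds).const_mul Complex.I
  filter_upwards [hz.eventually h, eventually_gt_atTop 0] with β hβ hβ₀ j
  have hone : -(Complex.I * β) * (Complex.I * (β : ℂ)⁻¹) = 1 := by
    linear_combination (exp := 1) -Complex.I_mul_I * ((β : ℂ) * (β : ℂ)⁻¹)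
      + mul_inv_cancel₀ (Complex.ofReal_ne_zero.2 hβ₀.ne')
  have hpencil : Ω - (Complex.I * β) • B =
      (-(Complex.I * β)) • (B + (Complex.I * (β : ℂ)⁻¹) • Ω) := by
    rw [smul_add, smul_smul, hone, one_smul, neg_smul, add_comm, sub_eq_add_neg]
  rw [hpencil, smul_apply, hβ j, smul_smul, pencilMode]

theorem exists_isPencilModeFamily [FiniteDimensional ℂ V] (hB : IsSymmetricAlong J B)
    (hΩ : IsSymmetricAlong J Ω) (hJ : Function.Injective J) :
    ∃ (ι : Type) (_ : Fintype ι) (b : Module.Basis ι ℂ V) (μ : ι → ℂ) (ρ : ι → ℝ)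
      (ζ : ι → ℝ → ℂ) (w : ι → ℝ → V), IsPencilModeFamily B Ω b μ ρ ζ w := by
  obtain ⟨ι, hι, b, e, l, he, hl, he₀, hel⟩ :=
    (isSymmetricFamily_add_smul hB hΩ hJ).hasAnalyticEigenbasis
  have hloss : ∀ j, B (b j) = l j 0 • b j := fun j => by simpa [he₀] using hel.self_of_nhds j
  have hcomp : ∀ j, l j 0 = 0 → Ω (b j) - deriv (l j) 0 • b j ∈ B.range := fun j hj =>
    ⟨-deriv (e j) 0, by
      rw [← he₀ j, ← apply_deriv_add_apply_eq (he j) (hl j) (hel.mono fun _ hz => hz j) hj]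
      simp⟩
  have hreal : ∀ j, l j 0 = 0 → ((deriv (l j) 0).re : ℂ) = deriv (l j) 0 := fun j hj =>
    Complex.conj_eq_iff_re.1 (conj_eq_of_apply_sub_smul_mem_range hB hΩ hJ (b.ne_zero j)
      (by rw [hloss, hj, zero_smul]) (hcomp j hj))
  have hvec := fun j => AnalyticAtInfinity.of_analyticAt (analyticAt_comp_I_mul (he j))
    (.of_forall fun _ => rfl) (by rw [mul_zero, he₀])
  refine ⟨ι, hι, b, fun j => l j 0, fun j => (deriv (l j) 0).re, fun j => pencilMode (l j),
    fun j β => e j (Complex.I * (β : ℂ)⁻¹), eventually_pencilMode_eigen hel,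
    fun j => (hvec j).1, fun j => (hvec j).2, hloss,
    fun j => hasPoleAtInfinity_pencilMode (hl j),
    fun j hj => (pencilMode_of_apply_zero_eq_zero (hl j) hj).1,
    fun j hj => ?_, fun j hj => by rw [hreal j hj]; exact hcomp j hj⟩
  rw [hreal j hj]
  exact (pencilMode_of_apply_zero_eq_zero (hl j) hj).2

namespace IsPencilModeFamily

variable {ι : Type*} [Finite ι] {b : Module.Basis ι ℂ V} {μ : ι → ℂ} {ρ : ι → ℝ}
  {ζ : ι → ℝ → ℂ} {w : ι → ℝ → V}

theorem natCard_high_loss (h : IsPencilModeFamily B Ω b μ ρ ζ w) :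
    Nat.card {j // μ j ≠ 0} = Module.finrank ℂ B.range := by
  have : FiniteDimensional ℂ V := b.finiteDimensional_of_finite
  have hker := natCard_eigenvalue_eq_zero (f := B.toLinearMap) h.loss_eigen
  have hsum : Nat.card {j // μ j = 0} + Nat.card {j // μ j ≠ 0} = Module.finrank ℂ V := by
    classical
    rw [← Nat.card_sum, Nat.card_congr (Equiv.sumCompl fun j => μ j = 0),
      Module.finrank_eq_nat_card_basis b]
  have hrank := LinearMap.finrank_range_add_finrank_ker B.toLinearMap
  omega

theorem natCard_low_loss_low_q (h : IsPencilModeFamily B Ω b μ ρ ζ w) :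
    Nat.card {j // μ j = 0 ∧ ρ j = 0} =
      Module.finrank ℂ (compressionKernel (B : V →ₗ[ℂ] V) (Ω : V →ₗ[ℂ] V)) := by
  rw [← natCard_compression_eigenvalue_eq_zero (f := B.toLinearMap) (a := fun j => (ρ j : ℂ))
    h.loss_eigen h.compression_eigen]
  simp only [Complex.ofReal_eq_zero]

theorem exists_sorted [FiniteDimensional ℂ V] {n : ℕ} (hn : Module.finrank ℂ V = n)
    (h : IsPencilModeFamily B Ω b μ ρ ζ w) :
    ∃ e : Fin n ≃ ι, (∀ j : Fin n, (j : ℕ) < Module.finrank ℂ B.range ↔ μ (e j) ≠ 0) ∧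
      ∀ j : Fin n, (j : ℕ) < Module.finrank ℂ B.range +
        Module.finrank ℂ (compressionKernel (B : V →ₗ[ℂ] V) (Ω : V →ₗ[ℂ] V)) ↔
          μ (e j) ≠ 0 ∨ ρ (e j) = 0 := by
  classical
  let key : ι → ℕ := fun j => if μ j ≠ 0 then 0 else if ρ j = 0 then 1 else 2
  have hkey₀ : ∀ j, key j ≤ 0 ↔ μ j ≠ 0 := fun j => by grind
  have hkey₁ : ∀ j, key j ≤ 1 ↔ μ j ≠ 0 ∨ (μ j = 0 ∧ ρ j = 0) := fun j => by grind
  obtain ⟨e, he⟩ := exists_equiv_fin_lt_natCard_iff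
    ((Module.finrank_eq_nat_card_basis b).symm.trans hn) key
  refine ⟨e, fun j => ?_, fun j => ?_⟩
  · rw [← h.natCard_high_loss, ← hkey₀, ← he j 0]
    simp only [hkey₀]
  · have hdisj : Disjoint (fun j => μ j ≠ 0) (fun j => μ j = 0 ∧ ρ j = 0) :=
      Pi.disjoint_iff.2 fun j => by simp +contextual [Prop.disjoint_iff]
    rw [← h.natCard_high_loss, ← h.natCard_low_loss_low_q, ← Nat.card_sum,
      ← Nat.card_congr (subtypeOrEquiv _ _ hdisj), show μ (e j) ≠ 0 ∨ ρ (e j) = 0 ↔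
        μ (e j) ≠ 0 ∨ (μ (e j) = 0 ∧ ρ (e j) = 0) by tauto, ← hkey₁, ← he j 1]
    simp only [hkey₁]

end IsPencilModeFamily

end Pencil

section MatrixFacts

open scoped Matrix ComplexOrder

variable {n : Type*}

theorem conjTranspose_map_ofReal (M : Matrix n n ℝ) :
    (M.map Complex.ofReal)ᴴ = Mᵀ.map Complex.ofReal := by
  ext i j
  simp

open scoped Classical in
theorem transpose_cfcSqrt [Fintype n] (M : Matrix n n ℝ) : (CFC.sqrt M)ᵀ = CFC.sqrt M := by
  rw [← Matrix.conjTranspose_eq_transpose_of_trivial, ← Matrix.star_eq_conjTranspose,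
    (CFC.sqrt_nonneg M).isSelfAdjoint.star_eq]

theorem posSemidef_map_ofReal [Finite n] {M : Matrix n n ℝ} (hM : M.PosSemidef) :
    (M.map Complex.ofReal).PosSemidef := by
  classical
  have := Fintype.ofFinite n
  have hsq : M = (CFC.sqrt M)ᵀ * CFC.sqrt M := by
    rw [transpose_cfcSqrt, CFC.sqrt_mul_sqrt_self _ hM.nonneg]
  have hmul : M.map Complex.ofReal =
      ((CFC.sqrt M).map Complex.ofReal)ᴴ * (CFC.sqrt M).map Complex.ofReal := by
    conv_lhs => rw [hsq]
    rw [conjTranspose_map_ofReal]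
    exact Matrix.map_mul (f := Complex.ofRealHom)
  rw [hmul]
  exact Matrix.posSemidef_conjTranspose_mul_self _

variable [Fintype n]

theorem rank_map_ringHom {K L : Type*} [Field K] [Field L] (f : K →+* L)
    (M : Matrix n n K) : (M.map f).rank = M.rank := by
  classical
  obtain ⟨V, U, e, hV, hU, hM⟩ := Matrix.exists_rank_normal_form M
  rw [← Matrix.diagonal_one, ← Matrix.diagonal_zero, Matrix.fromBlocks_diagonal,
    Matrix.submatrix_diagonal_equiv] at hM
  generalize Sum.elim (fun _ => (1 : K)) (fun _ => 0) ∘ e = d at hM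
  have hM' : V.map f * M.map f * U.map f = Matrix.diagonal (f ∘ d) := by
    rw [← Matrix.map_mul, ← Matrix.map_mul, hM, Matrix.diagonal_map (map_zero f)]
    rfl
  have hdet : ∀ X : Matrix n n K, IsUnit X → IsUnit X.det ∧ IsUnit (X.map f).det := fun X hX =>
    ⟨X.isUnit_iff_isUnit_det.1 hX, (Matrix.isUnit_iff_isUnit_det _).1 (hX.map f.mapMatrix)⟩
  rw [← Matrix.rank_mul_eq_right_of_isUnit_det V M (hdet V hV).1,
    ← Matrix.rank_mul_eq_left_of_isUnit_det U (V * M) (hdet U hU).1, hM,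
    ← Matrix.rank_mul_eq_right_of_isUnit_det (V.map f) (M.map f) (hdet V hV).2,
    ← Matrix.rank_mul_eq_left_of_isUnit_det (U.map f) (V.map f * M.map f) (hdet U hU).2, hM',
    Matrix.rank_diagonal, Matrix.rank_diagonal]
  simp only [Function.comp_apply, map_ne_zero]

theorem re_map_ofReal_mulVec (M : Matrix n n ℝ) (v : n → ℂ) (i : n) :
    ((M.map Complex.ofReal *ᵥ v) i).re = (M *ᵥ fun j => (v j).re) i := by
  simp [Matrix.mulVec, dotProduct]

theorem im_map_ofReal_mulVec (M : Matrix n n ℝ) (v : n → ℂ) (i : n) :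
    ((M.map Complex.ofReal *ᵥ v) i).im = (M *ᵥ fun j => (v j).im) i := by
  simp [Matrix.mulVec, dotProduct]

theorem map_ofReal_mulVec_eq_zero_iff {M : Matrix n n ℝ} {v : n → ℂ} :
    M.map Complex.ofReal *ᵥ v = 0 ↔
      (M *ᵥ fun j => (v j).re) = 0 ∧ (M *ᵥ fun j => (v j).im) = 0 := by
  simp only [funext_iff, ← re_map_ofReal_mulVec, ← im_map_ofReal_mulVec, Complex.ext_iff,
    Pi.zero_apply, Complex.zero_re, Complex.zero_im, forall_and]

theorem exists_mulVec_add_conjTranspose_mulVec_eq {m : Type*} [Fintype m] {L : Matrix n n ℂ}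
    (hL : L.PosSemidef) {Φ : Matrix m n ℂ} (h : ∀ x, L *ᵥ x = 0 → Φ *ᵥ x = 0 → x = 0) (x : n → ℂ) :
    ∃ y, L *ᵥ y + Φᴴ *ᵥ (Φ *ᵥ y) = x := by
  have hΦ := Matrix.posSemidef_conjTranspose_mul_self Φ
  have hinj : Function.Injective (L + Φᴴ * Φ).mulVecLin :=
    (injective_iff_map_eq_zero _).2 fun y (hy : (L + Φᴴ * Φ) *ᵥ y = 0) => by
      have hsum : star y ⬝ᵥ L *ᵥ y + star y ⬝ᵥ (Φᴴ * Φ) *ᵥ y = 0 := by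
        rw [← dotProduct_add, ← Matrix.add_mulVec, hy, dotProduct_zero]
      obtain ⟨hLy, hΦy⟩ := (add_eq_zero_iff_of_nonneg (hL.dotProduct_mulVec_nonneg y)
        (hΦ.dotProduct_mulVec_nonneg y)).1 hsum
      exact h y ((hL.dotProduct_mulVec_zero_iff y).1 hLy)
        ((Matrix.conjTranspose_mul_self_mulVec_eq_zero Φ y).1
          ((hΦ.dotProduct_mulVec_zero_iff y).1 hΦy))
  obtain ⟨y, hy⟩ := LinearMap.injective_iff_surjective.1 hinj x
  exact ⟨y, by rw [← hy, Matrix.mulVecLin_apply, Matrix.add_mulVec, Matrix.mulVec_mulVec]⟩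

theorem finrank_comap_range_add_card {m : Type*} [Fintype m] {L : Matrix n n ℂ}
    (hL : L.PosSemidef) {Φ : Matrix m n ℂ} (h : ∀ x, L *ᵥ x = 0 → Φ *ᵥ x = 0 → x = 0) :
    Module.finrank ℂ (L.mulVecLin.range.comap Φᴴ.mulVecLin) + Fintype.card n =
      L.rank + Fintype.card m := by
  set π := L.mulVecLin.range.mkQ ∘ₗ Φᴴ.mulVecLin with hπ
  have hker : π.ker = L.mulVecLin.range.comap Φᴴ.mulVecLin := by
    rw [hπ, LinearMap.ker_comp, Submodule.ker_mkQ]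
  have hrange : π.range = ⊤ := LinearMap.range_eq_top.2 fun q => by
    obtain ⟨x, rfl⟩ := Submodule.mkQ_surjective _ q
    obtain ⟨y, rfl⟩ := exists_mulVec_add_conjTranspose_mulVec_eq hL h x
    exact ⟨Φ *ᵥ y, (Submodule.Quotient.eq _).2 ⟨-y, by simp [Matrix.mulVec_neg]⟩⟩
  have hdim := π.finrank_range_add_finrank_ker
  have hquot := L.mulVecLin.range.finrank_quotient_add_finrank
  rw [hrange, finrank_top, hker, Module.finrank_fintype_fun_eq_card] at hdim
  rw [Module.finrank_fintype_fun_eq_card] at hquot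
  rw [Matrix.rank]
  omega

end MatrixFacts

namespace LagrangianSystem

open scoped Matrix ComplexOrder

variable {N : ℕ} (S : LagrangianSystem N)

/-- The operator `K_p R K_pᵀ` on `ℂ^N`, the nonzero block of the dissipation operator. -/
noncomputable def lossBlock : Matrix (Fin N) (Fin N) ℂ :=
  (S.Kp * S.R * S.Kpᵀ).map Complex.ofReal

/-- The operator `K_p θ K_pᵀ` on `ℂ^N`, the gyroscopic part of the frequency operator. -/
noncomputable def gyroBlock : Matrix (Fin N) (Fin N) ℂ :=
  (S.Kp * S.θ * S.Kpᵀ).map Complex.ofReal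

/-- The operator `Φ` on `ℂ^N`, the off-diagonal part of the frequency operator. -/
noncomputable def stiffBlock : Matrix (Fin N) (Fin N) ℂ :=
  S.Phi.map Complex.ofReal

theorem B_eq : S.B = Matrix.fromBlocks S.lossBlock 0 0 0 := rfl

theorem Omega_eq : S.Omega = Matrix.fromBlocks ((-2 * Complex.I) • S.gyroBlock)
    ((-Complex.I) • S.stiffBlockᴴ) (Complex.I • S.stiffBlock) 0 := by
  rw [stiffBlock, conjTranspose_map_ofReal]
  rfl

theorem Kp_transpose : S.Kpᵀ = S.Kp := by
  rw [Kp, Matrix.transpose_nonsing_inv, transpose_cfcSqrt]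

theorem isUnit_Kp : IsUnit S.Kp := by
  have hsq : IsUnit (CFC.sqrt S.α * CFC.sqrt S.α) := by
    rw [CFC.sqrt_mul_sqrt_self _ S.α_posDef.posSemidef.nonneg]
    exact S.α_posDef.isUnit
  exact Matrix.isUnit_nonsing_inv_iff.2 (isUnit_of_mul_isUnit_left hsq)

theorem lossBlock_posSemidef : S.lossBlock.PosSemidef := by
  refine posSemidef_map_ofReal ?_
  rw [← Matrix.conjTranspose_eq_transpose_of_trivial]
  exact S.R_posSemidef.mul_mul_conjTranspose_same S.Kp

theorem gyroBlock_conjTranspose : S.gyroBlockᴴ = -S.gyroBlock := by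
  rw [gyroBlock, conjTranspose_map_ofReal, Matrix.transpose_mul, Matrix.transpose_mul,
    Matrix.transpose_transpose, S.θ_skew, Matrix.neg_mul, Matrix.mul_neg, ← Matrix.mul_assoc]
  exact Matrix.map_neg _ Complex.ofReal_neg _

theorem Omega_isHermitian : S.Omega.IsHermitian := by
  rw [Omega_eq]
  refine Matrix.IsHermitian.fromBlocks ?_ (by simp) Matrix.isHermitian_zero
  simp [Matrix.IsHermitian, Matrix.conjTranspose_smul, gyroBlock_conjTranspose]

theorem B_posSemidef : S.B.PosSemidef := by
  let P : Matrix (Fin N) (Fin N ⊕ Fin N) ℂ := Matrix.fromCols 1 0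
  have hB : S.B = Pᴴ * S.lossBlock * P := by
    rw [B_eq, Matrix.conjTranspose_fromCols_eq_fromRows_conjTranspose, Matrix.fromRows_mul,
      Matrix.fromRows_mul_fromCols]
    simp
  rw [hB]
  exact S.lossBlock_posSemidef.conjTranspose_mul_mul_same P

theorem B_mulVec (w : Fin N ⊕ Fin N → ℂ) :
    S.B *ᵥ w = Sum.elim (S.lossBlock *ᵥ (w ∘ Sum.inl)) 0 := by
  simp [B_eq, Matrix.fromBlocks_mulVec]

theorem Omega_mulVec (w : Fin N ⊕ Fin N → ℂ) :
    S.Omega *ᵥ w = Sum.elim ((-2 * Complex.I) • S.gyroBlock *ᵥ (w ∘ Sum.inl) -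
        Complex.I • S.stiffBlockᴴ *ᵥ (w ∘ Sum.inr))
      (Complex.I • S.stiffBlock *ᵥ (w ∘ Sum.inl)) := by
  simp [Omega_eq, Matrix.fromBlocks_mulVec, Matrix.smul_mulVec, Matrix.neg_mulVec, sub_eq_add_neg]

theorem eq_zero_of_lossBlock_of_stiffBlock
    (hker : LinearMap.ker S.R.mulVecLin ⊓ LinearMap.ker S.η.mulVecLin = ⊥)
    {x : Fin N → ℂ} (hR : S.lossBlock *ᵥ x = 0) (hΦ : S.stiffBlock *ᵥ x = 0) : x = 0 := by
  have hKp : Function.Injective S.Kp.mulVec := Matrix.mulVec_injective_iff_isUnit.2 S.isUnit_Kp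
  have hreal : ∀ a : Fin N → ℝ, (S.Kp * S.R * S.Kpᵀ) *ᵥ a = 0 → S.Phi *ᵥ a = 0 → a = 0 := by
    intro a hRa hΦa
    rw [Kp_transpose, ← Matrix.mulVec_mulVec, ← Matrix.mulVec_mulVec] at hRa
    rw [Phi, Kp_transpose, ← Matrix.mulVec_mulVec] at hΦa
    have hmem : S.Kp *ᵥ a ∈ LinearMap.ker S.R.mulVecLin ⊓ LinearMap.ker S.η.mulVecLin := by
      refine ⟨hKp (hRa.trans (Matrix.mulVec_zero _).symm), ?_⟩
      change S.η *ᵥ (S.Kp *ᵥ a) = 0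
      rw [← CFC.sqrt_mul_sqrt_self _ S.η_posSemidef.nonneg, ← Matrix.mulVec_mulVec]
      exact (congrArg _ hΦa).trans (Matrix.mulVec_zero _)
    rw [hker, Submodule.mem_bot] at hmem
    exact hKp (hmem.trans (Matrix.mulVec_zero _).symm)
  obtain ⟨hRre, hRim⟩ := map_ofReal_mulVec_eq_zero_iff.1 hR
  obtain ⟨hΦre, hΦim⟩ := map_ofReal_mulVec_eq_zero_iff.1 hΦ
  exact funext fun i => Complex.ext (congrFun (hreal _ hRre hΦre) i)
    (congrFun (hreal _ hRim hΦim) i)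

theorem rank_lossBlock : S.lossBlock.rank = S.lossRank := by
  have hKp := (Matrix.isUnit_iff_isUnit_det _).1 S.isUnit_Kp
  refine (rank_map_ringHom Complex.ofRealHom _).trans ?_
  rw [Kp_transpose, Matrix.rank_mul_eq_left_of_isUnit_det _ _ hKp,
    Matrix.rank_mul_eq_right_of_isUnit_det _ _ hKp, lossRank]

variable (N) in
/-- The embedding `φ ↦ (φ, 0)` of `ℂ^N` into `ℂ^{2N}`. -/
def inlMap : (Fin N → ℂ) →ₗ[ℂ] (Fin N ⊕ Fin N → ℂ) :=
  (LinearEquiv.sumArrowLequivProdArrow (Fin N) (Fin N) ℂ ℂ).symm.toLinearMap ∘ₗ LinearMap.inl ℂ _ _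

variable (N) in
/-- The embedding `ψ ↦ (0, ψ)` of `ℂ^N` into `ℂ^{2N}`. -/
def inrMap : (Fin N → ℂ) →ₗ[ℂ] (Fin N ⊕ Fin N → ℂ) :=
  (LinearEquiv.sumArrowLequivProdArrow (Fin N) (Fin N) ℂ ℂ).symm.toLinearMap ∘ₗ LinearMap.inr ℂ _ _

theorem inlMap_apply (x : Fin N → ℂ) : inlMap N x = (Sum.elim x 0 : Fin N ⊕ Fin N → ℂ) := rfl

theorem inrMap_apply (x : Fin N → ℂ) : inrMap N x = (Sum.elim 0 x : Fin N ⊕ Fin N → ℂ) := rfl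

theorem inlMap_injective : Function.Injective (inlMap N) := fun _ _ h =>
  congrArg (· ∘ Sum.inl) h

theorem inrMap_injective : Function.Injective (inrMap N) := fun _ _ h =>
  congrArg (· ∘ Sum.inr) h

theorem range_B : S.B.mulVecLin.range = S.lossBlock.mulVecLin.range.map (inlMap N) := by
  ext w
  constructor
  · rintro ⟨u, rfl⟩
    exact ⟨_, ⟨u ∘ Sum.inl, rfl⟩, (S.B_mulVec u).symm⟩
  · rintro ⟨_, ⟨x, rfl⟩, rfl⟩
    exact ⟨Sum.elim x 0, S.B_mulVec _⟩

theorem finrank_range_B : Module.finrank ℂ S.B.mulVecLin.range = S.lossRank := by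
  rw [range_B, ← (Submodule.equivMapOfInjective _ inlMap_injective _).finrank_eq,
    ← rank_lossBlock, Matrix.rank]

theorem compressionKernel_B_Omega
    (hker : LinearMap.ker S.R.mulVecLin ⊓ LinearMap.ker S.η.mulVecLin = ⊥) :
    compressionKernel S.B.mulVecLin S.Omega.mulVecLin =
      (S.lossBlock.mulVecLin.range.comap S.stiffBlockᴴ.mulVecLin).map (inrMap N) := by
  ext w
  rw [compressionKernel, range_B]
  constructor
  · rintro ⟨hB : S.B *ᵥ w = 0, x, hx, hΩ : _ = S.Omega *ᵥ w⟩
    rw [B_mulVec] at hB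
    rw [inlMap_apply, Omega_mulVec] at hΩ
    have hL : S.lossBlock *ᵥ (w ∘ Sum.inl) = 0 := congrArg (· ∘ Sum.inl) hB
    have hΦ : S.stiffBlock *ᵥ (w ∘ Sum.inl) = 0 :=
      (smul_eq_zero.1 (congrArg (· ∘ Sum.inr) hΩ).symm).resolve_left Complex.I_ne_zero
    have hinl := S.eq_zero_of_lossBlock_of_stiffBlock hker hL hΦ
    have hinr : x = -(Complex.I • S.stiffBlockᴴ *ᵥ (w ∘ Sum.inr)) := by
      have := congrArg (· ∘ Sum.inl) hΩ
      simpa [hinl] using this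
    refine ⟨w ∘ Sum.inr, ?_, by rw [inrMap_apply, ← hinl, Sum.elim_comp_inl_inr]⟩
    rw [SetLike.mem_coe, Submodule.mem_comap, Matrix.mulVecLin_apply,
      ← Submodule.smul_mem_iff _ Complex.I_ne_zero, ← neg_mem_iff, ← hinr]
    exact hx
  · rintro ⟨ψ, hψ, rfl⟩
    constructor
    · change S.B *ᵥ _ = 0
      rw [inrMap_apply, B_mulVec, Sum.elim_comp_inl, Matrix.mulVec_zero, Sum.elim_zero_zero]
    · refine ⟨-(Complex.I • S.stiffBlockᴴ *ᵥ ψ), neg_mem (Submodule.smul_mem _ _ hψ), ?_⟩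
      rw [Matrix.mulVecLin_apply, inrMap_apply, inlMap_apply, Omega_mulVec]
      simp

theorem finrank_compressionKernel_B_Omega
    (hker : LinearMap.ker S.R.mulVecLin ⊓ LinearMap.ker S.η.mulVecLin = ⊥) :
    Module.finrank ℂ (compressionKernel S.B.mulVecLin S.Omega.mulVecLin) = S.lossRank := by
  have hcard := finrank_comap_range_add_card (Φ := S.stiffBlock) S.lossBlock_posSemidef
    fun _ => S.eq_zero_of_lossBlock_of_stiffBlock hker
  rw [rank_lossBlock] at hcard
  rw [S.compressionKernel_B_Omega hker,
    ← (Submodule.equivMapOfInjective _ inrMap_injective _).finrank_eq]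
  exact Nat.add_right_cancel hcard

end LagrangianSystem

theorem isSymmetricAlong_of_isHermitian {n : Type*} [Fintype n] {M : Matrix n n ℂ}
    (hM : M.IsHermitian) :
    IsSymmetricAlong ((EuclideanSpace.equiv n ℂ).symm : (n → ℂ) →L[ℂ] EuclideanSpace ℂ n)
      M.mulVecLin.toContinuousLinearMap := fun u v => by
  change inner ℂ (WithLp.toLp 2 (M.mulVec u)) (WithLp.toLp 2 v) =
    inner ℂ (WithLp.toLp 2 u) (WithLp.toLp 2 (M.mulVec v))
  rw [EuclideanSpace.inner_toLp_toLp, EuclideanSpace.inner_toLp_toLp, Matrix.star_mulVec, hM.eq,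
    dotProduct_comm, ← Matrix.dotProduct_mulVec, dotProduct_comm]

section LimitMatching

variable {ι α : Type*} [Fintype ι]

theorem exists_perm_comp_eq_of_map_univ_eq {f g : ι → α}
    (h : Finset.univ.val.map f = Finset.univ.val.map g) : ∃ σ : Equiv.Perm ι, g ∘ σ = f := by
  classical
  have hcard : ∀ a, Nonempty ({i // f i = a} ≃ {i // g i = a}) := fun a => by
    have hcount := congrArg (Multiset.count a) h
    simp only [Multiset.count_map, eq_comm (a := a)] at hcount
    exact Fintype.card_eq.1 ((Fintype.card_subtype _).trans
      (hcount.trans (Fintype.card_subtype _).symm))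
  exact ⟨Equiv.ofFiberEquiv fun a => (hcard a).some, funext (Equiv.ofFiberEquiv_map _)⟩

theorem exists_perm_comp_eq_of_tendsto {T : Type*} [TopologicalSpace α] [T2Space α] {l : Filter T}
    {f g : ι → T → α} {c d : ι → α} (hf : ∀ i, Tendsto (f i) l (𝓝 (c i)))
    (hg : ∀ i, Tendsto (g i) l (𝓝 (d i)))
    (h : ∃ᶠ t in l, Finset.univ.val.map (f · t) = Finset.univ.val.map (g · t)) :
    ∃ σ : Equiv.Perm ι, d ∘ σ = c := by
  obtain ⟨σ, hσ⟩ := frequently_exists.1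
    (h.mono fun _ ht => exists_perm_comp_eq_of_map_univ_eq ht)
  exact ⟨σ, funext fun i => tendsto_nhds_unique_of_frequently_eq (hg (σ i)) (hf i)
    (hσ.mono fun _ ht => congrFun ht i)⟩

end LimitMatching

theorem exists_perm_fixing_of_comp_eq {ι α : Type*} {p : ι → Prop} {c d : ι → α}
    {σ : Equiv.Perm ι} (hσ : d ∘ σ = c) (hp : ∀ j, p (σ j) ↔ p j) :
    ∃ τ : Equiv.Perm ι, (∀ j, ¬p j → τ j = j) ∧ ∀ j, p j → p (τ j) ∧ c (τ j) = d j := by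
  classical
  have hinv : ∀ j, p (σ.symm j) ↔ p j := fun j => by rw [← hp (σ.symm j), σ.apply_symm_apply]
  refine ⟨Equiv.Perm.ofSubtype (Equiv.Perm.subtypePerm σ.symm hinv),
    fun j hj => Equiv.Perm.ofSubtype_apply_of_not_mem _ hj, fun j hj => ?_⟩
  rw [Equiv.Perm.ofSubtype_apply_of_mem _ hj, Equiv.Perm.subtypePerm_apply]
  exact ⟨(hinv j).2 hj, by rw [← hσ, Function.comp_apply, σ.apply_symm_apply]⟩

namespace LagrangianSystem

open scoped Matrix ComplexOrder

variable {N : ℕ} (S : LagrangianSystem N)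

theorem A_mulVec (β : ℝ) (w : Fin N ⊕ Fin N → ℂ) :
    S.A β *ᵥ w = S.Omega *ᵥ w - (Complex.I * β) • S.B *ᵥ w := by
  rw [A, Matrix.sub_mulVec, Matrix.smul_mulVec]

theorem exists_isModeFamily : ∃ ζ w, S.IsModeFamily ζ w ∧
    (LinearMap.ker S.R.mulVecLin ⊓ LinearMap.ker S.η.mulVecLin = ⊥ → S.IsIndexedByLimits ζ) := by
  obtain ⟨ι, _, b, μ, ρ, ζ, w, h⟩ := exists_isPencilModeFamily
    (isSymmetricAlong_of_isHermitian S.B_posSemidef.isHermitian)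
    (isSymmetricAlong_of_isHermitian S.Omega_isHermitian)
    (EuclideanSpace.equiv (Fin N ⊕ Fin N) ℂ).symm.injective
  obtain ⟨e, he, he₀⟩ := h.exists_sorted (n := 2 * N) (by simp [two_mul])
  have hrank : Module.finrank ℂ S.B.mulVecLin.toContinuousLinearMap.range = S.lossRank :=
    S.finrank_range_B
  rw [hrank] at he he₀
  have hlow : ∀ j : Fin (2 * N), S.lossRank ≤ (j : ℕ) → μ (e j) = 0 := fun j hj =>
    not_not.1 fun hμ => hj.not_gt ((he j).2 hμ)
  have h' := h.comp_equiv e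
  refine ⟨ζ ∘ e, w ∘ e, ⟨?_, h'.eventually_linearIndependent, h'.vec_analytic,
    fun j hj => h'.high_loss j ((he j).1 hj), fun j hj => h'.low_loss j (hlow j hj)⟩,
    fun hker => ?_⟩
  · exact h'.eigen.mono fun β hβ j => (S.A_mulVec β _).trans (hβ j)
  have hker' : Module.finrank ℂ (compressionKernel
      (S.B.mulVecLin.toContinuousLinearMap : (Fin N ⊕ Fin N → ℂ) →ₗ[ℂ] _)
      (S.Omega.mulVecLin.toContinuousLinearMap : (Fin N ⊕ Fin N → ℂ) →ₗ[ℂ] _)) = S.lossRank :=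
    S.finrank_compressionKernel_B_Omega hker
  rw [hker', ← two_mul] at he₀
  refine ⟨fun j hj hj' => ?_, fun j hj => ⟨ρ (e j), fun hρ => ?_, ?_⟩⟩
  · have hρ : ρ (e j) = 0 := ((he₀ j).1 hj').resolve_left (not_not.2 (hlow j hj))
    simpa [hρ] using h'.low_loss_tendsto j (hlow j hj)
  · exact hj.not_gt ((he₀ j).2 (.inr hρ))
  · exact h'.low_loss_tendsto j (hlow j (by omega))

namespace IsModeFamily

variable {S} {ζ : Fin (2 * N) → ℝ → ℂ} {w : Fin (2 * N) → ℝ → (Fin N ⊕ Fin N → ℂ)}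

theorem map_eigenvalues_eq_roots (h : S.IsModeFamily ζ w) : ∀ᶠ β : ℝ in atTop,
    Finset.univ.val.map (ζ · β) = (S.A β).mulVecLin.charpoly.roots := by
  filter_upwards [h.eigen, h.basis] with β hβ hli
  let b := basisOfLinearIndependentOfCardEqFinrank' _ hli (by simp [two_mul])
  exact map_eigenvalues_eq_roots_charpoly (b := b) fun j => by simpa [b] using hβ j

theorem exists_tendsto_onePoint (h : S.IsModeFamily ζ w) (j : Fin (2 * N)) :
    ∃ c : OnePoint ℂ, Tendsto (fun β => (ζ j β : OnePoint ℂ)) atTop (𝓝 c) ∧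
      (c = OnePoint.infty ↔ (j : ℕ) < S.lossRank) := by
  rcases lt_or_ge (j : ℕ) S.lossRank with hj | hj
  · have hcobounded := tendsto_norm_atTop_iff_cobounded.1 (h.high_loss j hj).tendsto_norm
    rw [Metric.cobounded_eq_cocompact, ← coclosedCompact_eq_cocompact] at hcobounded
    exact ⟨_, OnePoint.tendsto_coe_infty.comp hcobounded, iff_of_true rfl hj⟩
  · obtain ⟨c, hc⟩ := (h.low_loss j hj).exists_tendsto
    exact ⟨c, (OnePoint.continuous_coe.tendsto c).comp hc,
      iff_of_false (OnePoint.coe_ne_infty c) hj.not_gt⟩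

theorem exists_perm_isIndexedByLimits (h : S.IsModeFamily ζ w)
    (hker : LinearMap.ker S.R.mulVecLin ⊓ LinearMap.ker S.η.mulVecLin = ⊥) :
    ∃ σ : Equiv.Perm (Fin (2 * N)), (∀ j : Fin (2 * N), (j : ℕ) < S.lossRank → σ j = j) ∧
      S.IsIndexedByLimits fun j => ζ (σ j) := by
  obtain ⟨ζ', w', h', hidx⟩ := S.exists_isModeFamily
  choose c hc hc_high using h.exists_tendsto_onePoint
  choose d hd hd_high using h'.exists_tendsto_onePoint
  obtain ⟨σ, hσ⟩ := exists_perm_comp_eq_of_tendsto hc hd <| Eventually.frequently <| by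
    filter_upwards [h.map_eigenvalues_eq_roots, h'.map_eigenvalues_eq_roots] with β hβ hβ'
    simpa only [Multiset.map_map, Function.comp_def] using
      congrArg (Multiset.map OnePoint.some) (hβ.trans hβ'.symm)
  have hlow : ∀ j, S.lossRank ≤ (σ j : ℕ) ↔ S.lossRank ≤ (j : ℕ) := fun j => by
    have hdc : d (σ j) = c j := congrFun hσ j
    rw [← not_lt, ← not_lt, ← hd_high, hdc, hc_high]
  obtain ⟨τ, hfix, hτ⟩ := exists_perm_fixing_of_comp_eq
    (p := fun j : Fin (2 * N) => S.lossRank ≤ (j : ℕ)) hσ hlow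
  have hlim : ∀ j : Fin (2 * N), S.lossRank ≤ (j : ℕ) → ∀ {ρ : ℂ},
      Tendsto (ζ' j) atTop (𝓝 ρ) → Tendsto (ζ (τ j)) atTop (𝓝 ρ) := fun j hj ρ hρ => by
    have hd_eq : d j = ρ :=
      tendsto_nhds_unique (hd j) ((OnePoint.continuous_coe.tendsto ρ).comp hρ)
    rw [OnePoint.isOpenEmbedding_coe.isInducing.tendsto_nhds_iff, ← hd_eq, ← (hτ j hj).2]
    exact hc (τ j)
  obtain ⟨hidx₀, hidx₁⟩ := hidx hker
  refine ⟨τ, fun j hj => hfix j hj.not_ge, fun j hj hj' => hlim j hj (hidx₀ j hj hj'),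
    fun j hj => ?_⟩
  obtain ⟨ρ, hρ, hζ'⟩ := hidx₁ j hj
  exact ⟨ρ, hρ, hlim j (by omega) hζ'⟩

end IsModeFamily

end LagrangianSystem

section DissipativeEigenvalues

open scoped Matrix ComplexOrder

variable {n : Type*} [Fintype n] {M P : Matrix n n ℂ}

theorem exists_abs_re_dotProduct_mulVec_le (M : Matrix n n ℂ) :
    ∃ C : ℝ, ∀ x : n → ℂ, |(star x ⬝ᵥ M *ᵥ x).re| ≤ C * (star x ⬝ᵥ x).re := by
  classical
  have hinner : ∀ x y : n → ℂ, star x ⬝ᵥ y = inner ℂ (WithLp.toLp 2 x) (WithLp.toLp 2 y) :=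
    fun x y => by rw [EuclideanSpace.inner_toLp_toLp, dotProduct_comm]
  refine ⟨‖Matrix.toEuclideanCLM (𝕜 := ℂ) M‖, fun x => ?_⟩
  have hnorm : (star x ⬝ᵥ x).re = ‖WithLp.toLp 2 x‖ * ‖WithLp.toLp 2 x‖ := by
    rw [hinner, ← pow_two]
    exact inner_self_eq_norm_sq (𝕜 := ℂ) _
  rw [hnorm, hinner]
  calc _ ≤ ‖WithLp.toLp 2 x‖ * ‖WithLp.toLp 2 (M *ᵥ x)‖ :=
        (Complex.abs_re_le_norm _).trans (norm_inner_le_norm _ _)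
    _ ≤ ‖WithLp.toLp 2 x‖ * (‖Matrix.toEuclideanCLM (𝕜 := ℂ) M‖ * ‖WithLp.toLp 2 x‖) := by
        gcongr
        exact (Matrix.toEuclideanCLM (𝕜 := ℂ) M).le_opNorm _
    _ = _ := by ring

theorem star_dotProduct_mulVec_eq (M : Matrix n n ℂ) (x y : n → ℂ) :
    star x ⬝ᵥ M *ᵥ y = star (Mᴴ *ᵥ x) ⬝ᵥ y := by
  rw [Matrix.star_mulVec, Matrix.conjTranspose_conjTranspose, Matrix.dotProduct_mulVec]

section

variable {β : ℝ} {ζ : ℂ} {w : n → ℂ}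

theorem dotProduct_mulVec_of_mulVec_sub_eq_smul
    (h : M *ᵥ w - (Complex.I * β) • P *ᵥ w = ζ • w) :
    ζ * (star w ⬝ᵥ w) = star w ⬝ᵥ M *ᵥ w - Complex.I * β * (star w ⬝ᵥ P *ᵥ w) := by
  simpa only [dotProduct_sub, dotProduct_smul, smul_eq_mul] using
    (congrArg (star w ⬝ᵥ ·) h).symm

theorem im_nonpos_of_mulVec_sub_eq_smul (hM : M.IsHermitian) (hP : P.PosSemidef) (hβ : 0 ≤ β)
    (hw : w ≠ 0) (h : M *ᵥ w - (Complex.I * β) • P *ᵥ w = ζ • w) : ζ.im ≤ 0 := by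
  have hww := Complex.pos_iff.1 (Matrix.dotProduct_star_self_pos_iff.2 hw)
  have hPw := Complex.nonneg_iff.1 (hP.dotProduct_mulVec_nonneg w)
  have hMw : (star w ⬝ᵥ M *ᵥ w).im = 0 := hM.im_star_dotProduct_mulVec_self w
  have him : ζ.im * (star w ⬝ᵥ w).re = -(β * (star w ⬝ᵥ P *ᵥ w).re) := by
    simpa [hMw, ← hww.2, ← hPw.2] using
      congrArg Complex.im (dotProduct_mulVec_of_mulVec_sub_eq_smul h)
  exact nonpos_of_mul_nonpos_left (him.trans_le (neg_nonpos.2 (mul_nonneg hβ hPw.1))) hww.1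

theorem abs_re_le_of_mulVec_sub_eq_smul {C : ℝ}
    (hC : ∀ x : n → ℂ, |(star x ⬝ᵥ M *ᵥ x).re| ≤ C * (star x ⬝ᵥ x).re) (hP : P.IsHermitian)
    (hw : w ≠ 0) (h : M *ᵥ w - (Complex.I * β) • P *ᵥ w = ζ • w) : |ζ.re| ≤ C := by
  have hww := Complex.pos_iff.1 (Matrix.dotProduct_star_self_pos_iff.2 hw)
  have hPw : (star w ⬝ᵥ P *ᵥ w).im = 0 := hP.im_star_dotProduct_mulVec_self w
  have hre : ζ.re * (star w ⬝ᵥ w).re = (star w ⬝ᵥ M *ᵥ w).re := by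
    simpa [← hww.2, hPw] using congrArg Complex.re (dotProduct_mulVec_of_mulVec_sub_eq_smul h)
  refine le_of_mul_le_mul_right ?_ hww.1
  rw [← abs_of_pos hww.1, ← abs_mul, hre, abs_of_pos hww.1]
  exact hC w

end

theorem tendsto_mulVec {T : Type*} {l : Filter T} {v : T → n → ℂ} {v₀ : n → ℂ} (M : Matrix n n ℂ)
    (hv : Tendsto v l (𝓝 v₀)) : Tendsto (fun t => M *ᵥ v t) l (𝓝 (M *ᵥ v₀)) :=
  ((continuous_const.matrix_mulVec continuous_id).tendsto v₀).comp hv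

theorem mulVec_eq_zero_of_tendsto {ζ : ℝ → ℂ} {v : ℝ → n → ℂ} {ζ₀ : ℂ} {v₀ : n → ℂ}
    (hζ : Tendsto ζ atTop (𝓝 ζ₀)) (hv : Tendsto v atTop (𝓝 v₀))
    (h : ∀ᶠ β : ℝ in atTop, M *ᵥ v β - (Complex.I * β) • P *ᵥ v β = ζ β • v β) :
    P *ᵥ v₀ = 0 := by
  have hlim : Tendsto (fun β : ℝ => (Complex.I⁻¹ * (β : ℂ)⁻¹) • (M *ᵥ v β - ζ β • v β)) atTop
      (𝓝 0) := by
    simpa using ((tendsto_inv_ofReal_atTop.mono_right nhdsWithin_le_nhds).const_mul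
      Complex.I⁻¹).smul ((tendsto_mulVec M hv).sub (hζ.smul hv))
  refine tendsto_nhds_unique ((tendsto_mulVec P hv).congr' ?_) hlim
  filter_upwards [h, eventually_gt_atTop 0] with β hβ hβ₀
  have hne : Complex.I * β ≠ 0 := mul_ne_zero Complex.I_ne_zero (Complex.ofReal_ne_zero.2 hβ₀.ne')
  rw [← hβ, sub_sub_cancel, ← mul_inv, inv_smul_smul₀ hne]

theorem eventually_eq_zero_of_smul_eq_mulVec {T : Type*} {l : Filter T} {ζ : T → ℂ}
    {φ ψ : T → n → ℂ} {ψ₀ : n → ℂ} (hψ : Tendsto ψ l (𝓝 ψ₀)) (hψ₀ : ψ₀ ≠ 0)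
    (hM : Mᴴ *ᵥ ψ₀ = 0) (h : ∀ᶠ t in l, M *ᵥ φ t = ζ t • ψ t) : ∀ᶠ t in l, ζ t = 0 := by
  have hdot : Tendsto (fun t => star ψ₀ ⬝ᵥ ψ t) l (𝓝 (star ψ₀ ⬝ᵥ ψ₀)) :=
    ((continuous_const.dotProduct continuous_id).tendsto ψ₀).comp hψ
  filter_upwards [h, hdot.eventually_ne (Matrix.dotProduct_star_self_pos_iff.2 hψ₀).ne']
    with t ht hne
  have hzero : ζ t * (star ψ₀ ⬝ᵥ ψ t) = 0 := by
    rw [← smul_eq_mul, ← dotProduct_smul, ← ht, star_dotProduct_mulVec_eq, hM, star_zero,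
      zero_dotProduct]
  exact (mul_eq_zero.1 hzero).resolve_right hne

theorem mul_dotProduct_of_conjTranspose_mulVec_eq {L Φ : Matrix n n ℂ} {φ ψ : n → ℂ} {ζ : ℂ}
    (hL : L.IsHermitian) (hψ : Φᴴ *ᵥ ψ = -(L *ᵥ φ)) (hφ : Complex.I • Φ *ᵥ φ = ζ • ψ) :
    ζ * (star ψ ⬝ᵥ ψ) = -Complex.I * (star φ ⬝ᵥ L *ᵥ φ) := by
  calc ζ * (star ψ ⬝ᵥ ψ) = Complex.I * (star ψ ⬝ᵥ Φ *ᵥ φ) := by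
        rw [← smul_eq_mul, ← dotProduct_smul, ← hφ, dotProduct_smul, smul_eq_mul]
    _ = -Complex.I * (star (L *ᵥ φ) ⬝ᵥ φ) := by
        rw [star_dotProduct_mulVec_eq, hψ, star_neg, neg_dotProduct, mul_neg, neg_mul]
    _ = -Complex.I * (star φ ⬝ᵥ L *ᵥ φ) := by
        rw [star_dotProduct_mulVec_eq L, hL.eq]

theorem re_eq_zero_of_conjTranspose_mulVec_eq {L Φ : Matrix n n ℂ} {φ ψ : n → ℂ} {ζ : ℂ}
    (hL : L.IsHermitian) (hψ₀ : ψ ≠ 0) (hψ : Φᴴ *ᵥ ψ = -(L *ᵥ φ))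
    (hφ : Complex.I • Φ *ᵥ φ = ζ • ψ) : ζ.re = 0 := by
  have hψψ := Complex.pos_iff.1 (Matrix.dotProduct_star_self_pos_iff.2 hψ₀)
  have hLφ : (star φ ⬝ᵥ L *ᵥ φ).im = 0 := hL.im_star_dotProduct_mulVec_self φ
  have hre := congrArg Complex.re (mul_dotProduct_of_conjTranspose_mulVec_eq hL hψ hφ)
  simpa [← hψψ.2, hLφ, hψψ.1.ne'] using hre

theorem conjTranspose_mulVec_eq_zero {L Φ : Matrix n n ℂ} {φ ψ : n → ℂ} (hL : L.PosSemidef)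
    (hψ : Φᴴ *ᵥ ψ = -(L *ᵥ φ)) (hφ : Φ *ᵥ φ = 0) : Φᴴ *ᵥ ψ = 0 := by
  have hquad := mul_dotProduct_of_conjTranspose_mulVec_eq (ζ := 0) hL.isHermitian hψ (by simp [hφ])
  have hLφ : star φ ⬝ᵥ L *ᵥ φ = 0 := by simpa using hquad
  rw [hψ, (hL.dotProduct_mulVec_zero_iff φ).1 hLφ, neg_zero]

end DissipativeEigenvalues

namespace LagrangianSystem

open scoped Matrix ComplexOrder

variable {N : ℕ} (S : LagrangianSystem N)

theorem im_nonpos_of_A_mulVec_eq_smul {β : ℝ} {ζ : ℂ} {w : Fin N ⊕ Fin N → ℂ} (hβ : 0 ≤ β)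
    (hw : w ≠ 0) (h : S.A β *ᵥ w = ζ • w) : ζ.im ≤ 0 :=
  im_nonpos_of_mulVec_sub_eq_smul S.Omega_isHermitian S.B_posSemidef hβ hw
    ((S.A_mulVec β w).symm.trans h)

theorem A_mulVec_eq_smul_iff {β : ℝ} {ζ : ℂ} {w : Fin N ⊕ Fin N → ℂ} :
    S.A β *ᵥ w = ζ • w ↔
      (-2 * Complex.I) • S.gyroBlock *ᵥ (w ∘ Sum.inl) -
          Complex.I • S.stiffBlockᴴ *ᵥ (w ∘ Sum.inr) -
          (Complex.I * β) • S.lossBlock *ᵥ (w ∘ Sum.inl) = ζ • (w ∘ Sum.inl) ∧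
        Complex.I • S.stiffBlock *ᵥ (w ∘ Sum.inl) = ζ • (w ∘ Sum.inr) := by
  rw [A_mulVec, Omega_mulVec, B_mulVec]
  simp [funext_iff, Sum.forall]

theorem comp_inl_eq_zero_of_tendsto {ζ : ℝ → ℂ} {v : ℝ → Fin N ⊕ Fin N → ℂ}
    {v₀ : Fin N ⊕ Fin N → ℂ}
    (hker : LinearMap.ker S.R.mulVecLin ⊓ LinearMap.ker S.η.mulVecLin = ⊥)
    (heig : ∀ᶠ β in atTop, S.A β *ᵥ v β = ζ β • v β) (hζ : Tendsto ζ atTop (𝓝 0))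
    (hv : Tendsto v atTop (𝓝 v₀)) : v₀ ∘ Sum.inl = 0 := by
  have hB : S.B *ᵥ v₀ = 0 :=
    mulVec_eq_zero_of_tendsto hζ hv (heig.mono fun β hβ => (S.A_mulVec β _).symm.trans hβ)
  rw [B_mulVec] at hB
  have hinr : ∀ᶠ β in atTop,
      Complex.I • S.stiffBlock *ᵥ (v β ∘ Sum.inl) = ζ β • (v β ∘ Sum.inr) :=
    heig.mono fun β hβ => (S.A_mulVec_eq_smul_iff.1 hβ).2
  have hΦ := tendsto_nhds_unique_of_eventuallyEq
    ((tendsto_mulVec S.stiffBlock (((Pi.continuous_precomp _).tendsto v₀).comp hv)).const_smul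
      Complex.I) (hζ.smul (((Pi.continuous_precomp _).tendsto v₀).comp hv)) hinr
  rw [zero_smul] at hΦ
  exact S.eq_zero_of_lossBlock_of_stiffBlock hker (congrArg (· ∘ Sum.inl) hB)
    ((smul_eq_zero.1 hΦ).resolve_left Complex.I_ne_zero)

theorem tendsto_second_order {ζ : ℝ → ℂ} {v : ℝ → Fin N ⊕ Fin N → ℂ}
    {ζ₁ : ℂ} {φ₁ ψ₀ : Fin N → ℂ} (heig : ∀ᶠ β in atTop, S.A β *ᵥ v β = ζ β • v β)
    (hζ : Tendsto ζ atTop (𝓝 0)) (hζ₁ : Tendsto (fun β : ℝ => (β : ℂ) • ζ β) atTop (𝓝 ζ₁))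
    (hφ : Tendsto (fun β => v β ∘ Sum.inl) atTop (𝓝 0))
    (hφ₁ : Tendsto (fun β : ℝ => (β : ℂ) • (v β ∘ Sum.inl)) atTop (𝓝 φ₁))
    (hψ : Tendsto (fun β => v β ∘ Sum.inr) atTop (𝓝 ψ₀)) :
    S.stiffBlockᴴ *ᵥ ψ₀ = -(S.lossBlock *ᵥ φ₁) ∧ Complex.I • S.stiffBlock *ᵥ φ₁ = ζ₁ • ψ₀ := by
  constructor
  · have hlhs := (((tendsto_mulVec S.gyroBlock hφ).const_smul (-2 * Complex.I)).sub
      ((tendsto_mulVec S.stiffBlockᴴ hψ).const_smul Complex.I)).sub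
      ((tendsto_mulVec S.lossBlock hφ₁).const_smul Complex.I)
    have hlim := tendsto_nhds_unique_of_eventuallyEq hlhs (hζ.smul hφ) <| by
      filter_upwards [heig] with β hβ
      rw [Matrix.mulVec_smul, smul_smul]
      exact (S.A_mulVec_eq_smul_iff.1 hβ).1
    rw [Matrix.mulVec_zero, smul_zero, zero_sub, smul_zero, ← neg_add', neg_eq_zero, ← smul_add]
      at hlim
    exact eq_neg_of_add_eq_zero_left ((smul_eq_zero.1 hlim).resolve_left Complex.I_ne_zero)
  · refine tendsto_nhds_unique_of_eventuallyEq
      ((tendsto_mulVec S.stiffBlock hφ₁).const_smul Complex.I) (hζ₁.smul hψ) ?_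
    filter_upwards [heig] with β hβ
    rw [Matrix.mulVec_smul, smul_comm, (S.A_mulVec_eq_smul_iff.1 hβ).2, smul_assoc]

theorem exists_second_order_limits {ζ : ℝ → ℂ} {v : ℝ → Fin N ⊕ Fin N → ℂ}
    {v₀ : Fin N ⊕ Fin N → ℂ}
    (hker : LinearMap.ker S.R.mulVecLin ⊓ LinearMap.ker S.η.mulVecLin = ⊥)
    (heig : ∀ᶠ β in atTop, S.A β *ᵥ v β = ζ β • v β) (hζ_an : AnalyticAtInfinity ζ)
    (hv_an : AnalyticAtInfinity v) (hζ : Tendsto ζ atTop (𝓝 0)) (hv : Tendsto v atTop (𝓝 v₀)) :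
    v₀ ∘ Sum.inl = 0 ∧ ∃ (ζ₁ : ℂ) (φ₁ : Fin N → ℂ),
      Tendsto (fun β : ℝ => (β : ℂ) • ζ β) atTop (𝓝 ζ₁) ∧
      S.stiffBlockᴴ *ᵥ (v₀ ∘ Sum.inr) = -(S.lossBlock *ᵥ φ₁) ∧
      Complex.I • S.stiffBlock *ᵥ φ₁ = ζ₁ • (v₀ ∘ Sum.inr) := by
  have hφ₀ : v₀ ∘ Sum.inl = 0 := S.comp_inl_eq_zero_of_tendsto hker heig hζ hv
  have hφ : Tendsto (fun β => v β ∘ Sum.inl) atTop (𝓝 0) :=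
    hφ₀ ▸ ((Pi.continuous_precomp _).tendsto v₀).comp hv
  have hψ : Tendsto (fun β => v β ∘ Sum.inr) atTop (𝓝 (v₀ ∘ Sum.inr)) :=
    ((Pi.continuous_precomp _).tendsto v₀).comp hv
  obtain ⟨φ₁, hφ₁⟩ := (hv_an.clm_comp
    (LinearMap.funLeft ℂ ℂ Sum.inl).toContinuousLinearMap).exists_tendsto_smul hφ
  obtain ⟨ζ₁, hζ₁⟩ := hζ_an.exists_tendsto_smul hζ
  exact ⟨hφ₀, ζ₁, φ₁, hζ₁, S.tendsto_second_order heig hζ hζ₁ hφ hφ₁ hψ⟩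

theorem tendsto_qFactor_zero_of_tendsto_zero {ζ : ℝ → ℂ} {v : ℝ → Fin N ⊕ Fin N → ℂ}
    {v₀ : Fin N ⊕ Fin N → ℂ}
    (hker : LinearMap.ker S.R.mulVecLin ⊓ LinearMap.ker S.η.mulVecLin = ⊥)
    (heig : ∀ᶠ β in atTop, S.A β *ᵥ v β = ζ β • v β) (hζ_an : AnalyticAtInfinity ζ)
    (hv_an : AnalyticAtInfinity v) (hζ : Tendsto ζ atTop (𝓝 0)) (hv : Tendsto v atTop (𝓝 v₀))
    (hv₀ : v₀ ≠ 0) : Tendsto (fun β => qFactor (ζ β)) atTop (𝓝 0) := by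
  obtain ⟨hφ₀, ζ₁, φ₁, hζ₁, hL, hΦ⟩ :=
    S.exists_second_order_limits hker heig hζ_an hv_an hζ hv
  have hψ₀ : v₀ ∘ Sum.inr ≠ 0 := fun h => hv₀ <| by
    rw [← Sum.elim_comp_inl_inr v₀, hφ₀, h, Sum.elim_zero_zero]
  by_cases hζ₁_zero : ζ₁ = 0
  · rw [hζ₁_zero, zero_smul] at hΦ
    have hΦψ : S.stiffBlockᴴ *ᵥ (v₀ ∘ Sum.inr) = 0 :=
      conjTranspose_mulVec_eq_zero S.lossBlock_posSemidef hL
        ((smul_eq_zero.1 hΦ).resolve_left Complex.I_ne_zero)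
    have hzero : ∀ᶠ β in atTop, ζ β = 0 :=
      eventually_eq_zero_of_smul_eq_mulVec (φ := fun β => Complex.I • (v β ∘ Sum.inl))
        (((Pi.continuous_precomp _).tendsto v₀).comp hv) hψ₀ hΦψ
        (heig.mono fun β hβ => by
          rw [Matrix.mulVec_smul, (S.A_mulVec_eq_smul_iff.1 hβ).2, Function.comp_apply])
    exact tendsto_const_nhds.congr' (hzero.mono fun β hβ =>
      (qFactor_of_re_eq_zero (congrArg Complex.re hβ)).symm)
  · have him : ∀ᶠ β : ℝ in atTop, ((β : ℂ) • ζ β).im ≤ 0 := by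
      filter_upwards [heig, hv.eventually_ne hv₀, eventually_ge_atTop 0] with β hβ hne hβ₀
      rw [smul_eq_mul, Complex.im_ofReal_mul]
      exact mul_nonpos_of_nonneg_of_nonpos hβ₀ (S.im_nonpos_of_A_mulVec_eq_smul hβ₀ hne hβ)
    have hQ := tendsto_qFactor hζ₁_zero him hζ₁
    rw [qFactor_of_re_eq_zero (re_eq_zero_of_conjTranspose_mulVec_eq
      S.lossBlock_posSemidef.isHermitian hψ₀ hL hΦ)] at hQ
    refine hQ.congr' ?_
    filter_upwards [eventually_gt_atTop 0] with β hβ using qFactor_ofReal_mul hβ _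

namespace IsModeFamily

variable {S} {ζ : Fin (2 * N) → ℝ → ℂ} {w : Fin (2 * N) → ℝ → (Fin N ⊕ Fin N → ℂ)}

theorem eventually_ne_zero (h : S.IsModeFamily ζ w) (j : Fin (2 * N)) :
    ∀ᶠ β in atTop, w j β ≠ 0 :=
  h.basis.mono fun _ hβ => hβ.ne_zero j

theorem eventually_im_nonpos (h : S.IsModeFamily ζ w) (j : Fin (2 * N)) :
    ∀ᶠ β in atTop, (ζ j β).im ≤ 0 := by
  filter_upwards [h.eigen, h.eventually_ne_zero j, eventually_ge_atTop 0] with β hβ hw hβ₀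
  exact S.im_nonpos_of_A_mulVec_eq_smul hβ₀ hw (hβ j)

theorem exists_eventually_abs_re_le (h : S.IsModeFamily ζ w) (j : Fin (2 * N)) :
    ∃ C : ℝ, ∀ᶠ β in atTop, |(ζ j β).re| ≤ C := by
  obtain ⟨C, hC⟩ := exists_abs_re_dotProduct_mulVec_le S.Omega
  refine ⟨C, ?_⟩
  filter_upwards [h.eigen, h.eventually_ne_zero j] with β hβ hw
  exact abs_re_le_of_mulVec_sub_eq_smul hC S.B_posSemidef.isHermitian hw
    ((S.A_mulVec β _).symm.trans (hβ j))

theorem decreasesToZero_of_high_loss (h : S.IsModeFamily ζ w) {j : Fin (2 * N)}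
    (hj : (j : ℕ) < S.lossRank) : DecreasesToZero fun β => qFactor (ζ j β) := by
  obtain ⟨n, g, hg, hζ⟩ := (h.high_loss j hj).exists_eq_pow_mul
  obtain ⟨C, hC⟩ := h.exists_eventually_abs_re_le j
  exact (constOrStrictNear_qFactor_atTop hg hζ (h.eventually_im_nonpos j)).decreasesToZero
    (tendsto_qFactor_zero_of_norm_tendsto_atTop (h.eventually_im_nonpos j) hC
      (h.high_loss j hj).tendsto_norm)

theorem constOrStrictNear_qFactor_of_low_loss (h : S.IsModeFamily ζ w) {j : Fin (2 * N)}
    (hj : S.lossRank ≤ (j : ℕ)) : ConstOrStrictNear atTop fun β => qFactor (ζ j β) := by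
  obtain ⟨n, g, hg, hζ⟩ := (h.low_loss j hj).exists_eq_pow_mul
  exact constOrStrictNear_qFactor_atTop hg hζ (h.eventually_im_nonpos j)

theorem increasesToTop_of_tendsto_ofReal (h : S.IsModeFamily ζ w) {j : Fin (2 * N)}
    (hj : S.lossRank ≤ (j : ℕ)) {ρ : ℝ} (hρ : ρ ≠ 0) (hlim : Tendsto (ζ j) atTop (𝓝 ρ)) :
    IncreasesToTop fun β => qFactor (ζ j β) := by
  have hQ := tendsto_qFactor (Complex.ofReal_ne_zero.2 hρ) (h.eventually_im_nonpos j) hlim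
  rw [qFactor_ofReal hρ] at hQ
  exact (h.constOrStrictNear_qFactor_of_low_loss hj).increasesToTop hQ

theorem decreasesToZero_of_tendsto_zero (h : S.IsModeFamily ζ w)
    (hker : LinearMap.ker S.R.mulVecLin ⊓ LinearMap.ker S.η.mulVecLin = ⊥) {j : Fin (2 * N)}
    (hj : S.lossRank ≤ (j : ℕ)) (hlim : Tendsto (ζ j) atTop (𝓝 0)) :
    DecreasesToZero fun β => qFactor (ζ j β) := by
  obtain ⟨v, v₀, hv_an, hv₀, hv, hvw⟩ :=
    (h.vec_analytic j).exists_smul_tendsto_ne_zero (h.eventually_ne_zero j)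
  have heig : ∀ᶠ β in atTop, S.A β *ᵥ v β = ζ j β • v β := by
    filter_upwards [h.eigen, hvw] with β hβ ⟨c, hc⟩
    rw [hc, Matrix.mulVec_smul, hβ j, smul_comm]
  exact (h.constOrStrictNear_qFactor_of_low_loss hj).decreasesToZero
    (S.tendsto_qFactor_zero_of_tendsto_zero hker heig (h.low_loss j hj) hv_an hlim hv hv₀)

end IsModeFamily

end LagrangianSystem

theorem mainTheorem6 {N : ℕ} (S : LagrangianSystem N) :
    -- the eigenpairs of the high-loss regime exist
    (∃ (ζ : Fin (2 * N) → ℝ → ℂ) (w : Fin (2 * N) → ℝ → (Fin N ⊕ Fin N → ℂ)),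
      S.IsModeFamily ζ w) ∧
    -- high-loss modes
    (∀ (ζ : Fin (2 * N) → ℝ → ℂ) (w : Fin (2 * N) → ℝ → (Fin N ⊕ Fin N → ℂ)),
      S.IsModeFamily ζ w →
      ∀ j : Fin (2 * N), (j : ℕ) < S.lossRank → DecreasesToZero (fun β => qFactor (ζ j β))) ∧
    -- low-loss modes
    (LinearMap.ker S.R.mulVecLin ⊓ LinearMap.ker S.η.mulVecLin = ⊥ →
      -- the low-loss modes can be reindexed according to their limits
      (∀ (ζ : Fin (2 * N) → ℝ → ℂ) (w : Fin (2 * N) → ℝ → (Fin N ⊕ Fin N → ℂ)),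
        S.IsModeFamily ζ w →
        ∃ σ : Equiv.Perm (Fin (2 * N)), (∀ j : Fin (2 * N), (j : ℕ) < S.lossRank → σ j = j) ∧
          S.IsIndexedByLimits (fun j => ζ (σ j))) ∧
      -- and, once so indexed, are of low Q and of high Q respectively
      (∀ (ζ : Fin (2 * N) → ℝ → ℂ) (w : Fin (2 * N) → ℝ → (Fin N ⊕ Fin N → ℂ)),
        S.IsModeFamily ζ w → S.IsIndexedByLimits ζ →
        (∀ j : Fin (2 * N), S.lossRank ≤ (j : ℕ) → (j : ℕ) < 2 * S.lossRank →
          DecreasesToZero (fun β => qFactor (ζ j β))) ∧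
        (∀ j : Fin (2 * N), 2 * S.lossRank ≤ (j : ℕ) →
          IncreasesToTop (fun β => qFactor (ζ j β))))) := by
  refine ⟨?_, fun ζ w h j hj => h.decreasesToZero_of_high_loss hj, fun hker =>
    ⟨fun ζ w h => h.exists_perm_isIndexedByLimits hker, fun ζ w h hi => ⟨fun j hj hj' =>
      h.decreasesToZero_of_tendsto_zero hker hj (hi.1 j hj hj'), fun j hj => ?_⟩⟩⟩
  · obtain ⟨ζ, w, h, -⟩ := S.exists_isModeFamily
    exact ⟨ζ, w, h⟩
  · obtain ⟨ρ, hρ, hlim⟩ := hi.2 j hj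
    exact h.increasesToTop_of_tendsto_ofReal (by omega) hρ hlim
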